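/- Let $S^1\subset\mathbb R^2$ be the unit circle, $\sigma$ its arc-length measure, and $L^2=L^2(S^1,\sigma)$ the space of complex-valued square-integrable functions; put $\tilde f(x)=\overline{f(-x)}$, and let $R_t$ denote the rotation of the plane by $t$ radians about the origin. For $0<s<1$ let $\mathcal H^s$ be the set of all $f\in L^2$ with $$\|f\|_{\mathcal H^s}=\|f\|_{L^2}+\sup_{0<|t|\le 1}\frac{\|f\circ R_t-f\|_{L^2}}{|t|^s}<\infty ,$$ and for $t\ge 0$ let $H^t$ be the Sobolev space of all $f\in L^2$ with $\sum_{n\in\mathbb Z}(1+n^2)^t|\hat f(n)|^2<\infty$, where $\hat f(n)=\frac1{2\pi}\int_{-\pi}^{\pi}f(e^{i\theta})e^{-in\theta}\,d\theta$. Suppose that $f\in L^2$ satisfies, for some constant $\lambda\in\mathbb C$, the Euler--Lagrange equation $$f\sigma*f\sigma*f\sigma*\tilde f\sigma*\tilde f\sigma\,(x)=\lambda f(x)\qquad\text{for $\sigma$-almost every }x\in S^1 .$$ Here the left-hand side is the function $x\mapsto\int h(x-y)\,d(f\sigma*f\sigma*f\sigma)(y)$, where $h$ is the Lebesgue density on $\mathbb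 R^2$ of $\tilde f\sigma*\tilde f\sigma$. In particular, this covers the equation satisfied by the extremizers of the Tomas--Stein inequality $\|\widehat{f\sigma}\|_{L^6(\mathbb R^2)}\le\mathcal R\|f\|_{L^2}$, with $\mathcal R$ the optimal constant, where $\lambda=\mathcal R^6\|f\|_{L^2}^4$ (for the Fourier transform with kernel $e^{-2\pi i x\cdot\xi}$). Then there is some $s\in(0,1)$ such that $f\in\mathcal H^s$; in particular, $f\in H^t$ for all $0\le t<s$. -/

import Mathlib

open MeasureTheory
open scoped ENNReal ComplexConjugate

namespace TomasStein

/-! The plane `ℝ²` is `ℂ` (with its Euclidean norm and Lebesgue measure), and `S¹` is `Circle`. -/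

/-- The unit circle carries its Borel σ-algebra. -/
noncomputable instance instMeasurableSpaceCircle : MeasurableSpace Circle := borel Circle

instance instBorelSpaceCircle : BorelSpace Circle := ⟨rfl⟩

/-- Arc-length measure on the unit circle (of total mass `2π`). -/
noncomputable def σ : Measure Circle :=
  Measure.map Circle.exp (volume.restrict (Set.Ioc (-Real.pi) Real.pi))

/-- `tilde f (x)` is the complex conjugate of `f (-x)`. -/
noncomputable def tilde (f : Circle → ℂ) : Circle → ℂ := fun x => conj (f (-x))

/-- The convolution `fσ ∗ gσ` of two complex measures on the plane: the image of the product
measure `(f ⊗ g) d(σ × σ)` under addition. -/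
noncomputable def conv₂ (f g : Circle → ℂ) : ComplexMeasure ℂ :=
  ((σ.prod σ).withDensityᵥ fun p : Circle × Circle => f p.1 * g p.2).map
    fun p : Circle × Circle => (p.1 : ℂ) + (p.2 : ℂ)

/-- The density of `fσ ∗ gσ` with respect to Lebesgue measure on the plane. -/
noncomputable def convDensity₂ (f g : Circle → ℂ) : ℂ → ℂ :=
  ComplexMeasure.rnDeriv (conv₂ f g) (volume : Measure ℂ)

/-- The function `f₁σ ∗ f₂σ ∗ f₃σ ∗ f₄σ ∗ f₅σ` on the plane: the convolution of the
measure `f₁σ ∗ f₂σ ∗ f₃σ` with the density `h` of `f₄σ ∗ f₅σ`, that is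
`x ↦ ∫ h (x - y) d(f₁σ ∗ f₂σ ∗ f₃σ)(y)`. Since `σ ∗ σ ∗ σ` is absolutely continuous, the value at
every point `x` is unaffected by changing `h` on a Lebesgue null set, so that restricting this
function to the circle makes sense. -/
noncomputable def conv₅ (f₁ f₂ f₃ f₄ f₅ : Circle → ℂ) (x : ℂ) : ℂ :=
  ∫ p : Circle × Circle × Circle,
    f₁ p.1 * f₂ p.2.1 * f₃ p.2.2 *
      convDensity₂ f₄ f₅ (x - ((p.1 : ℂ) + (p.2.1 : ℂ) + (p.2.2 : ℂ))) ∂(σ.prod (σ.prod σ))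

/-- The Euler-Lagrange equation with multiplier `c`:
`fσ ∗ fσ ∗ fσ ∗ f̃σ ∗ f̃σ = c f` almost everywhere on the circle. -/
def EulerLagrange (c : ℂ) (f : Circle → ℂ) : Prop :=
  ∀ᵐ x : Circle ∂σ, conv₅ f f f (tilde f) (tilde f) (x : ℂ) = c * f x

/-- The function `f` rotated by the angle `t`. -/
noncomputable def rotate (t : ℝ) (f : Circle → ℂ) : Circle → ℂ := fun x => f (Circle.exp t * x)

/-- The norm `‖f‖_{L²} + sup_{0 < |t| ≤ 1} |t|^{-s} ‖f ∘ R_t - f‖_{L²}`, where `R_t` is the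
rotation by `t` radians, for `0 < s < 1`; it takes values in `[0, ∞]`. -/
noncomputable def calHNorm (s : ℝ) (f : Circle → ℂ) : ℝ≥0∞ :=
  eLpNorm f 2 σ +
    ⨆ (t : ℝ) (_ : 0 < |t| ∧ |t| ≤ 1),
      eLpNorm (fun x => rotate t f x - f x) 2 σ / ENNReal.ofReal (|t| ^ s)

/-- The space of all `f ∈ L²(S¹)` with finite `calHNorm s`, for `0 < s < 1`. -/
def MemCalH (s : ℝ) (f : Circle → ℂ) : Prop :=
  MemLp f 2 σ ∧ calHNorm s f < ∞

/-- The `n`-th Fourier coefficient on the circle. -/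
noncomputable def fourierCoefficient (f : Circle → ℂ) (n : ℤ) : ℂ :=
  (1 / (2 * Real.pi) : ℂ) * ∫ x : Circle, (x : ℂ) ^ (-n) * f x ∂σ

/-- Membership in the Sobolev space `H^t(S¹)` for `t ≥ 0`. -/
def MemSobolev (t : ℝ) (f : Circle → ℂ) : Prop :=
  MemLp f 2 σ ∧
    Summable fun n : ℤ => (1 + (n : ℝ) ^ 2) ^ t * ‖fourierCoefficient f n‖ ^ 2

end TomasStein

namespace TomasStein

open scoped NNReal

-- The equation is read weakly. Tested against `q`, its left-hand side is a trilinear form `tri` in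
-- three densities, each the density of a convolution of two functions on the circle: of `f` with
-- `f`, of the reflected `q` with `f`, and of `tilde f` with itself. The form integrates a product
-- over triples of points with sum zero, so it is symmetric and rotation invariant.
--
-- Two estimates control it. `eLpNorm_density_le` maps `L² × L²` into `L^{3/2}` of the plane: the
-- Jacobian of `(α, β) ↦ exp (iα) + exp (iβ)` has a `1/|sin (α - β)|` singularity, and the estimate
-- reduces to fractional integration with kernel `|sin|^(-1/2)`. `lintegral_trilinear_le` is Young's
-- inequality on `L^{3/2}` in each slot.
--
-- Let `D = f ∘ R - f` for a rotation `R = R_t`. Subtracting the equation from its rotate and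
-- testing with `conj D` gives `c ‖D‖²` as a sum of five forms, each with a difference (`D` or its
-- tilde) in the first density and a fixed `L^{3/2}` function, up to rotation, in the last slot.
-- Approximate that function by a Lipschitz one. The error costs `ε ‖D‖`; in the Lipschitz part the
-- rotation is moved onto the Lipschitz function and gains `|R - 1|`. This is
-- `exists_norm_tri_rotate_sub_le`. For `c ≠ 0` the `ε` term is absorbed, so `‖D‖ ≤ B |t|`.
--
-- For `c = 0`, testing with `conj f` gives `∫ |fσ ∗ fσ ∗ fσ|² = 0`; the cube of the Fourier
-- transform of `fσ` vanishes, hence `f = 0`. In both cases `t ↦ f ∘ R_t` is Lipschitz at `0` in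
-- `L²`, which gives the Hölder bound, and by Bessel's inequality the Sobolev bound.

local instance : Fact (0 < 2 * Real.pi) := ⟨Real.two_pi_pos⟩

/-! ### Arc-length measure: finiteness and rotation invariance, transported from `AddCircle`. -/

theorem σ_eq_map_addCircle :
    σ = Measure.map (AddCircle.toCircle : AddCircle (2 * Real.pi) → Circle) volume := by
  have h := AddCircle.measurePreserving_mk (2 * Real.pi) (-Real.pi)
  rw [← h.map_eq, Measure.map_map AddCircle.continuous_toCircle.measurable h.measurable, σ]
  have e : -Real.pi + 2 * Real.pi = Real.pi := by ring
  rw [e]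
  congr 1
  ext x
  simp [AddCircle.toCircle_apply_mk, Real.pi_ne_zero]

instance : IsFiniteMeasure σ := by
  rw [σ_eq_map_addCircle]; infer_instance

theorem lintegral_σ {g : Circle → ℝ≥0∞} (hg : Measurable g) :
    ∫⁻ x, g x ∂σ = ∫⁻ θ in Set.Ioc (-Real.pi) Real.pi, g (Circle.exp θ) := by
  rw [σ, lintegral_map hg Circle.exp.continuous.measurable]

theorem exists_exp_eq (a : Circle) : ∃ t : ℝ, Circle.exp t = a := ⟨_, Circle.exp_arg a⟩

instance : σ.IsMulLeftInvariant := by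
  constructor
  intro g
  obtain ⟨t, rfl⟩ := exists_exp_eq g
  rw [σ_eq_map_addCircle, Measure.map_map (measurable_const_mul _)
    AddCircle.continuous_toCircle.measurable]
  have h : (fun x => Circle.exp t * x) ∘ (AddCircle.toCircle : AddCircle (2 * Real.pi) → Circle) =
      AddCircle.toCircle ∘ (fun x => (t : AddCircle (2 * Real.pi)) + x) := by
    ext x
    simp [AddCircle.toCircle_add, AddCircle.toCircle_apply_mk, Real.pi_ne_zero]
  rw [h, ← Measure.map_map AddCircle.continuous_toCircle.measurable (measurable_const_add _),
    map_add_left_eq_self]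

theorem measurePreserving_mul (a : Circle) : MeasurePreserving (fun x => a * x) σ σ :=
  measurePreserving_mul_left σ a

theorem measurePreserving_neg : MeasurePreserving (fun x : Circle => -x) σ σ := by
  simpa using measurePreserving_mul (-1)

/-! ### Sum coordinates on the torus. -/

/-- The unit vector in the direction of `z`, rotated by the half-angle `arccos (‖z‖ / 2)`. -/
noncomputable def sumFst (z : ℂ) : Circle :=
  Circle.exp z.arg * Circle.exp (Real.arccos (‖z‖ / 2))

noncomputable def sumSnd (z : ℂ) : Circle :=
  Circle.exp z.arg * Circle.exp (-Real.arccos (‖z‖ / 2))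

/-- The Jacobian factor `1 / |sin (α - β)|` at the point `z = exp (i α) + exp (i β)`. -/
noncomputable def weight (z : ℂ) : ℝ := (Real.sin (2 * Real.arccos (‖z‖ / 2)))⁻¹

theorem measurable_sumFst : Measurable sumFst := by
  unfold sumFst
  have := Circle.exp.continuous.measurable
  have h := Real.continuous_arccos.measurable
  exact (this.comp Complex.measurable_arg).mul (this.comp (h.comp (by fun_prop)))

theorem measurable_sumSnd : Measurable sumSnd := by
  unfold sumSnd
  have := Circle.exp.continuous.measurable
  have h := Real.continuous_arccos.measurable
  exact (this.comp Complex.measurable_arg).mul (this.comp (h.comp (by fun_prop)).neg)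

theorem measurable_weight : Measurable weight := by
  unfold weight
  have h := Real.continuous_arccos.measurable
  exact (Real.measurable_sin.comp ((h.comp (by fun_prop)).const_mul 2)).inv

theorem weight_nonneg (z : ℂ) : 0 ≤ weight z := by
  refine inv_nonneg.2 (Real.sin_nonneg_of_nonneg_of_le_pi ?_ ?_)
  · linarith [Real.arccos_nonneg (‖z‖ / 2)]
  · have : Real.arccos (‖z‖ / 2) ≤ Real.pi / 2 := Real.arccos_le_pi_div_two.2 (by positivity)
    linarith

/-- For `‖z‖ ≥ 2` the value of `arccos` is `0` and `0⁻¹ = 0`, so `weight` vanishes there by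
convention. Integrals over the whole plane therefore need no indicator of the disc. -/
theorem norm_lt_two_of_weight_ne_zero {z : ℂ} (h : weight z ≠ 0) : ‖z‖ < 2 := by
  by_contra hz
  apply h
  have : Real.arccos (‖z‖ / 2) = 0 := Real.arccos_eq_zero.2 (by linarith)
  simp [weight, this]

theorem sumFst_add_sumSnd {z : ℂ} (hz : ‖z‖ ≤ 2) : (sumFst z : ℂ) + sumSnd z = z := by
  have h1 : Real.cos (Real.arccos (‖z‖ / 2)) = ‖z‖ / 2 :=
    Real.cos_arccos (by linarith [norm_nonneg z]) (by linarith)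
  have h2 : Complex.exp (Real.arccos (‖z‖ / 2) * Complex.I) +
      Complex.exp (-Real.arccos (‖z‖ / 2) * Complex.I) = ‖z‖ := by
    rw [← Complex.two_cos, ← Complex.ofReal_cos, h1]; push_cast; ring
  simp only [sumFst, sumSnd, Circle.coe_mul, Circle.coe_exp, Complex.ofReal_neg]
  rw [← mul_add, h2, mul_comm, Complex.norm_mul_exp_arg_mul_I]

theorem weight_exp_mul (a : Circle) (z : ℂ) : weight (a * z) = weight z := by
  simp [weight, Circle.norm_coe]

theorem exp_arg_mul (a : Circle) {z : ℂ} (hz : z ≠ 0) :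
    Circle.exp (a * z).arg = a * Circle.exp z.arg := by
  have hz' : (‖z‖ : ℂ) ≠ 0 := by simpa using hz
  apply Circle.ext
  have h1 := Complex.norm_mul_exp_arg_mul_I (a * z)
  have h2 := Complex.norm_mul_exp_arg_mul_I z
  rw [norm_mul, Circle.norm_coe, one_mul] at h1
  rw [Circle.coe_mul, Circle.coe_exp, Circle.coe_exp]
  apply mul_left_cancel₀ hz'
  rw [h1]; nth_rewrite 1 [← h2]; ring

theorem sumFst_mul (a : Circle) {z : ℂ} (hz : z ≠ 0) : sumFst (a * z) = a * sumFst z := by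
  simp [sumFst, exp_arg_mul a hz, mul_assoc, Circle.norm_coe]

theorem sumSnd_mul (a : Circle) {z : ℂ} (hz : z ≠ 0) : sumSnd (a * z) = a * sumSnd z := by
  simp [sumSnd, exp_arg_mul a hz, mul_assoc, Circle.norm_coe]

/-- Rotation invariance lets the second point be replaced by its rotation `c` relative to the first,
which separates the diagonal rotation from the angle between the points. -/
theorem lintegral_prod_σ_eq_shear {G : Circle × Circle → ℝ≥0∞} (hG : Measurable G) :
    ∫⁻ p, G p ∂(σ.prod σ) = ∫⁻ c, ∫⁻ x, G (x, x * c) ∂σ ∂σ := by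
  have h1 : Measurable fun p : Circle × Circle => G (p.2, p.2 * p.1) :=
    hG.comp (measurable_snd.prodMk (measurable_snd.mul measurable_fst))
  have h2 : Measurable fun p : Circle × Circle => G (p.1, p.1 * p.2) :=
    hG.comp (measurable_fst.prodMk (measurable_fst.mul measurable_snd))
  rw [lintegral_prod _ hG.aemeasurable, lintegral_lintegral_swap (f := fun c x => G (x, x * c)) h1.aemeasurable]
  refine lintegral_congr fun x => ?_
  exact (lintegral_mul_left_eq_self (fun y => G (x, y)) x).symm

theorem lintegral_σ_split {J : Circle → ℝ≥0∞} (hJ : Measurable J) :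
    ∫⁻ c, J c ∂σ =
      ∫⁻ δ in Set.Ioo 0 Real.pi, (J (Circle.exp δ) + J (Circle.exp (-δ))) := by
  have hpi := Real.pi_pos
  have hm : Measurable fun δ : ℝ => J (Circle.exp δ) := hJ.comp Circle.exp.continuous.measurable
  have h3 : Set.Ioc (-Real.pi) Real.pi = Set.Ioc (-Real.pi) 0 ∪ Set.Ioc 0 Real.pi :=
    (Set.Ioc_union_Ioc_eq_Ioc (by linarith) hpi.le).symm
  rw [lintegral_σ hJ, h3, lintegral_union measurableSet_Ioc
    (Set.Ioc_disjoint_Ioc_of_le le_rfl), lintegral_add_left hm, add_comm]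
  congr 1
  · exact setLIntegral_congr Ioo_ae_eq_Ioc.symm
  · have h4 : ∫⁻ δ in Set.Ioo 0 Real.pi, J (Circle.exp (-δ)) =
        ∫⁻ δ in Neg.neg '' Set.Ioo 0 Real.pi, J (Circle.exp δ) := by
      rw [lintegral_image_eq_lintegral_abs_deriv_mul measurableSet_Ioo
        (f' := fun _ => -1) (fun x _ => (hasDerivAt_neg x).hasDerivWithinAt)
        neg_injective.injOn]
      simp
    rw [h4]
    simp only [Set.image_neg_eq_neg, Set.neg_Ioo, neg_zero]
    exact setLIntegral_congr Ioo_ae_eq_Ioc.symm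

/-- The Jacobians cancel: for `r = 2 cos (δ/2)` one has `|dr/dδ| = sin (δ/2)`, polar coordinates
give `r`, and `weight` is `1 / sin δ`. -/
theorem ofReal_mul_weight {δ : ℝ} (h0 : 0 < δ) (h1 : δ < Real.pi) :
    ENNReal.ofReal |-Real.sin (δ / 2)| * (ENNReal.ofReal (2 * Real.cos (δ / 2)) *
      ENNReal.ofReal (Real.sin (2 * Real.arccos (2 * Real.cos (δ / 2) / 2)))⁻¹) = 1 := by
  have hs : 0 < Real.sin (δ / 2) := Real.sin_pos_of_pos_of_lt_pi (by linarith) (by linarith)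
  have hc : 0 < Real.cos (δ / 2) := Real.cos_pos_of_mem_Ioo ⟨by linarith, by linarith⟩
  have h3 : Real.arccos (2 * Real.cos (δ / 2) / 2) = δ / 2 := by
    rw [mul_div_cancel_left₀ _ two_ne_zero, Real.arccos_cos (by linarith) (by linarith)]
  rw [h3, Real.sin_two_mul, abs_neg, abs_of_pos hs, ← ENNReal.ofReal_mul (by positivity),
    ← ENNReal.ofReal_mul (by positivity)]
  rw [← ENNReal.ofReal_one]
  congr 1
  field_simp

/-- Integration over the torus in terms of the sum of the two points: every `z` with `0 < ‖z‖ < 2`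
is a sum of two points of the circle in exactly two ways. -/
theorem lintegral_prod_σ {G : Circle × Circle → ℝ≥0∞} (hG : Measurable G) :
    ∫⁻ p, G p ∂(σ.prod σ) =
      ∫⁻ z, ENNReal.ofReal (weight z) *
        (G (sumFst z, sumSnd z) + G (sumSnd z, sumFst z)) := by
  have hpi := Real.pi_pos
  have hexp : Measurable fun t : ℝ => Circle.exp t := Circle.exp.continuous.measurable
  set J : Circle → ℝ≥0∞ := fun c => ∫⁻ x, G (x, x * c) ∂σ with hJdef
  have hJ : Measurable J := by
    refine Measurable.lintegral_prod_right' (f := fun p : Circle × Circle => G (p.2, p.2 * p.1)) ?_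
    exact hG.comp (measurable_snd.prodMk (measurable_snd.mul measurable_fst))
  set I : ℝ → ℝ≥0∞ := fun γ => ∫⁻ θ in Set.Ioo (-Real.pi) Real.pi,
    G (Circle.exp θ * Circle.exp γ, Circle.exp θ * Circle.exp (-γ)) with hI
  -- The points at angles `θ + γ` and `θ - γ` have relative rotation `exp (-2iγ)`, and averaging
  -- over `θ` makes the common rotation irrelevant.
  have hIJ : ∀ γ, I γ = J (Circle.exp (-(2 * γ))) := by
    intro γ
    have hm : Measurable fun x : Circle => G (x * Circle.exp γ, x * Circle.exp (-γ)) :=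
      hG.comp ((measurable_id.mul_const _).prodMk (measurable_id.mul_const _))
    simp only [hI, hJdef]
    rw [setLIntegral_congr Ioo_ae_eq_Ioc, ← lintegral_σ hm,
      ← lintegral_mul_right_eq_self (fun x => G (x, x * Circle.exp (-(2 * γ)))) (Circle.exp γ)]
    refine lintegral_congr fun x => ?_
    rw [mul_assoc, ← Circle.exp_add]
    congr 4
    ring
  have hIm : Measurable I := by
    have : I = fun γ => J (Circle.exp (-(2 * γ))) := funext hIJ
    rw [this]
    exact hJ.comp (hexp.comp (by fun_prop))
  set g : ℂ → ℝ≥0∞ := fun z => ENNReal.ofReal (weight z) *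
        (G (sumFst z, sumSnd z) + G (sumSnd z, sumFst z)) with hg
  set W : ℝ → ℝ≥0∞ := fun r => ENNReal.ofReal (Real.sin (2 * Real.arccos (r / 2)))⁻¹ with hW
  have key : ∫⁻ z, g z = ∫⁻ r in Set.Ioi (0 : ℝ), ENNReal.ofReal r * W r *
      (I (Real.arccos (r / 2)) + I (-Real.arccos (r / 2))) := by
    rw [← Complex.lintegral_comp_polarCoord_symm]
    have h1 : ∀ p ∈ polarCoord.target, ENNReal.ofReal p.1 • g (Complex.polarCoord.symm p) =
        ENNReal.ofReal p.1 * W p.1 *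
          (G (Circle.exp p.2 * Circle.exp (Real.arccos (p.1 / 2)),
              Circle.exp p.2 * Circle.exp (-Real.arccos (p.1 / 2))) +
            G (Circle.exp p.2 * Circle.exp (-Real.arccos (p.1 / 2)),
              Circle.exp p.2 * Circle.exp (- -Real.arccos (p.1 / 2)))) := by
      rintro ⟨r, θ⟩ hp
      simp only [polarCoord_target, Set.mem_prod, Set.mem_Ioi, Set.mem_Ioo] at hp
      obtain ⟨hr, hθ⟩ := hp
      have ha : (Complex.polarCoord.symm (r, θ)).arg = θ := by
        rw [Complex.polarCoord_symm_apply]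
        push_cast
        exact Complex.arg_mul_cos_add_sin_mul_I hr ⟨hθ.1, hθ.2.le⟩
      have hn : ‖Complex.polarCoord.symm (r, θ)‖ = r := by
        rw [Complex.norm_polarCoord_symm, abs_of_pos hr]
      simp only [hg, hW, weight, sumFst, sumSnd, ha, hn, smul_eq_mul, neg_neg, mul_assoc]
    rw [setLIntegral_congr_fun polarCoord.open_target.measurableSet h1, polarCoord_target,
      Measure.volume_eq_prod, ← Measure.prod_restrict, lintegral_prod]
    · refine lintegral_congr fun r => ?_
      simp only
      rw [lintegral_const_mul, lintegral_add_left]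
      · exact hG.comp ((hexp.mul_const _).prodMk (hexp.mul_const _))
      · exact (hG.comp ((hexp.mul_const _).prodMk (hexp.mul_const _))).add
          (hG.comp ((hexp.mul_const _).prodMk (hexp.mul_const _)))
    · have ha := Real.continuous_arccos.measurable
      have ha' : Measurable fun p : ℝ × ℝ => Real.arccos (p.1 / 2) := ha.comp (by fun_prop)
      have hWm : Measurable fun p : ℝ × ℝ => W p.1 :=
        (Real.measurable_sin.comp (ha'.const_mul 2)).inv.ennreal_ofReal
      have hθ : Measurable fun p : ℝ × ℝ => Circle.exp p.2 := hexp.comp measurable_snd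
      refine Measurable.aemeasurable ((measurable_fst.ennreal_ofReal.mul hWm).mul (.add ?_ ?_))
      · exact hG.comp ((hθ.mul (hexp.comp ha')).prodMk (hθ.mul (hexp.comp ha'.neg)))
      · exact hG.comp ((hθ.mul (hexp.comp ha'.neg)).prodMk (hθ.mul (hexp.comp ha'.neg.neg)))
  rw [key, lintegral_prod_σ_eq_shear hG]
  change ∫⁻ c, J c ∂σ = _
  rw [lintegral_σ_split hJ]
  have himg : (fun δ : ℝ => 2 * Real.cos (δ / 2)) '' Set.Ioo 0 Real.pi = Set.Ioo 0 2 := by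
    ext r
    simp only [Set.mem_image, Set.mem_Ioo]
    constructor
    · rintro ⟨δ, ⟨h0, h1⟩, rfl⟩
      have hc : 0 < Real.cos (δ / 2) := Real.cos_pos_of_mem_Ioo ⟨by linarith, by linarith⟩
      have : Real.cos (δ / 2) < Real.cos 0 :=
        Real.cos_lt_cos_of_nonneg_of_le_pi le_rfl (by linarith) (by linarith)
      rw [Real.cos_zero] at this
      exact ⟨by linarith, by linarith⟩
    · rintro ⟨h0, h1⟩
      refine ⟨2 * Real.arccos (r / 2), ⟨?_, ?_⟩, ?_⟩
      · have := Real.arccos_pos.2 (show r / 2 < 1 by linarith)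
        linarith
      · have := Real.arccos_lt_pi_div_two.2 (show 0 < r / 2 by linarith)
        linarith
      · rw [mul_div_cancel_left₀ _ two_ne_zero, Real.cos_arccos (by linarith) (by linarith)]
        ring
  have hsub : ∫⁻ r in Set.Ioi (0 : ℝ), ENNReal.ofReal r * W r *
      (I (Real.arccos (r / 2)) + I (-Real.arccos (r / 2))) =
      ∫⁻ r in Set.Ioo (0 : ℝ) 2, ENNReal.ofReal r * W r *
      (I (Real.arccos (r / 2)) + I (-Real.arccos (r / 2))) := by
    rw [← lintegral_indicator measurableSet_Ioi, ← lintegral_indicator measurableSet_Ioo]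
    refine lintegral_congr fun r => ?_
    by_cases h2 : r < 2
    · simp [Set.indicator, h2]
    · have : Real.arccos (r / 2) = 0 := Real.arccos_eq_zero.2 (by linarith)
      simp [Set.indicator, h2, hW, this]
  -- Substitution `r = 2 cos (δ/2)`: the two branches `±arccos (r/2)` become the relative angles `δ`
  -- and `-δ`.
  rw [hsub, ← himg, lintegral_image_eq_lintegral_abs_deriv_mul measurableSet_Ioo
    (f' := fun δ => -Real.sin (δ / 2))]
  · refine setLIntegral_congr_fun measurableSet_Ioo fun δ hδ => ?_
    have h3 : Real.arccos (2 * Real.cos (δ / 2) / 2) = δ / 2 := by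
      rw [mul_div_cancel_left₀ _ two_ne_zero,
        Real.arccos_cos (by linarith [hδ.1]) (by linarith [hδ.2])]
    rw [← mul_assoc, hW, ofReal_mul_weight hδ.1 hδ.2, one_mul, h3, hIJ, hIJ, add_comm]
    congr 3 <;> ring
  · intro δ _
    have : HasDerivAt (fun δ : ℝ => 2 * Real.cos (δ / 2)) (2 * (-Real.sin (δ / 2) * (1 / 2))) δ :=
      (((hasDerivAt_id δ).div_const 2).cos).const_mul 2
    exact (this.congr_deriv (by ring)).hasDerivWithinAt
  · intro x hx y hy hxy
    have hxy' : Real.cos (x / 2) = Real.cos (y / 2) := by simpa using hxy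
    have h := Real.injOn_cos (x₁ := x / 2) ⟨by linarith [hx.1], by linarith [hx.2]⟩ (x₂ := y / 2)
      ⟨by linarith [hy.1], by linarith [hy.2]⟩ hxy'
    linarith

/-! ### Fractional integration on the circle with kernel `|sin|^(-1/2)`. -/

theorem le_sin_of_le_pi {δ : ℝ} (h0 : 0 < δ) (h1 : δ < Real.pi) :
    2 / Real.pi * δ ≤ Real.sin δ ∨ 2 / Real.pi * (Real.pi - δ) ≤ Real.sin δ := by
  rcases le_total δ (Real.pi / 2) with h | h
  · exact .inl (Real.mul_le_sin h0.le h)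
  · right
    rw [← Real.sin_pi_sub]
    exact Real.mul_le_sin (by linarith) (by linarith)

theorem setLIntegral_comp_mul_Ioo {φ : ℝ → ℝ≥0∞} {c T : ℝ} (hc : 0 < c) :
    ∫⁻ δ in Set.Ioo 0 T, φ (c * δ) ≤ ENNReal.ofReal c⁻¹ * ∫⁻ u in Set.Ioi 0, φ u := by
  have h := lintegral_image_eq_lintegral_abs_deriv_mul (measurableSet_Ioo (a := (0 : ℝ)) (b := T))
    (f := fun δ => c * δ) (f' := fun _ => c)
    (fun x _ => by simpa using ((hasDerivAt_id x).const_mul c).hasDerivWithinAt)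
    (mul_right_injective₀ hc.ne').injOn φ
  have h2 : ∫⁻ δ in Set.Ioo 0 T, φ (c * δ) =
      ENNReal.ofReal c⁻¹ * ∫⁻ δ in Set.Ioo 0 T, ENNReal.ofReal |c| * φ (c * δ) := by
    rw [lintegral_const_mul' _ _ ENNReal.ofReal_ne_top, ← mul_assoc, ← ENNReal.ofReal_mul
      (by positivity), abs_of_pos hc, inv_mul_cancel₀ hc.ne', ENNReal.ofReal_one, one_mul]
  rw [h2, ← h]
  gcongr
  rintro _ ⟨x, hx, rfl⟩
  exact mul_pos hc hx.1

theorem measurable_coe_circle : Measurable fun c : Circle => (c : ℂ) :=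
  Continuous.measurable (by fun_prop)

theorem measurable_abs_im : Measurable fun c : Circle => |(c : ℂ).im| :=
  continuous_abs.measurable.comp (Complex.measurable_im.comp measurable_coe_circle)

/-- Jordan's inequality bounds `|sin δ|` below by `2/π` times the distance to `0` or to `π`, and `φ`
is antitone. The two zeros and the two signs of `δ` give four copies, each contributing a factor
`π/2`. -/
theorem lintegral_abs_im_le {φ : ℝ → ℝ≥0∞} (hφ : AntitoneOn φ (Set.Ioi 0)) (hm : Measurable φ) :
    ∫⁻ c : Circle, φ |(c : ℂ).im| ∂σ ≤
      ENNReal.ofReal (2 * Real.pi) * ∫⁻ u in Set.Ioi 0, φ u := by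
  have hpi := Real.pi_pos
  have hm' : Measurable fun c : Circle => φ |(c : ℂ).im| :=
    hm.comp measurable_abs_im
  rw [lintegral_σ_split hm']
  set ψ : ℝ → ℝ≥0∞ := fun δ => φ (2 / Real.pi * δ)
  have hψ : Measurable ψ := hm.comp (by fun_prop)
  have h1 : ∀ δ ∈ Set.Ioo 0 Real.pi, φ |(Circle.exp δ : ℂ).im| + φ |(Circle.exp (-δ) : ℂ).im| ≤
      2 * (ψ δ + ψ (Real.pi - δ)) := by
    intro δ hδ
    have hs : 0 < Real.sin δ := Real.sin_pos_of_pos_of_lt_pi hδ.1 hδ.2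
    have e1 : |(Circle.exp δ : ℂ).im| = Real.sin δ := by
      rw [Circle.coe_exp, Complex.exp_ofReal_mul_I_im, abs_of_pos hs]
    have e2 : |(Circle.exp (-δ) : ℂ).im| = Real.sin δ := by
      rw [Circle.coe_exp, Complex.exp_ofReal_mul_I_im, Real.sin_neg, abs_neg, abs_of_pos hs]
    rw [e1, e2, ← two_mul]
    gcongr
    rcases le_sin_of_le_pi hδ.1 hδ.2 with h | h
    · exact (hφ (Set.mem_Ioi.2 (mul_pos (by positivity) hδ.1)) hs h).trans le_self_add
    · exact (hφ (Set.mem_Ioi.2 (mul_pos (by positivity) (by linarith [hδ.2]))) hs h).trans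
        le_add_self
  have h2 : ∫⁻ δ in Set.Ioo 0 Real.pi, ψ (Real.pi - δ) = ∫⁻ δ in Set.Ioo 0 Real.pi, ψ δ := by
    have := lintegral_image_eq_lintegral_abs_deriv_mul
      (measurableSet_Ioo (a := (0 : ℝ)) (b := Real.pi))
      (f := fun δ => Real.pi - δ) (f' := fun _ => -1)
      (fun x _ => by simpa using ((hasDerivAt_id x).const_sub Real.pi).hasDerivWithinAt)
      (sub_right_injective.injOn) ψ
    simpa using this.symm
  calc _ ≤ ∫⁻ δ in Set.Ioo 0 Real.pi, 2 * (ψ δ + ψ (Real.pi - δ)) :=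
        setLIntegral_mono' measurableSet_Ioo h1
    _ = 4 * ∫⁻ δ in Set.Ioo 0 Real.pi, ψ δ := by
        rw [lintegral_const_mul' _ _ (by simp), lintegral_add_left hψ, h2]
        ring
    _ ≤ 4 * (ENNReal.ofReal (2 / Real.pi)⁻¹ * ∫⁻ u in Set.Ioi 0, φ u) := by
        gcongr
        exact setLIntegral_comp_mul_Ioo (by positivity)
    _ = _ := by
        rw [← mul_assoc]
        congr 1
        have : (4 : ℝ≥0∞) = ENNReal.ofReal 4 := by simp
        rw [this, ← ENNReal.ofReal_mul (by norm_num), inv_div]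
        congr 1
        ring

/-- The kernel `|sin (α - β)| ^ (-1/2)` as a function of `exp (i (α - β))`. -/
noncomputable def kern (c : Circle) : ℝ≥0∞ := ENNReal.ofReal (|(c : ℂ).im| ^ (-(1 / 2) : ℝ))

theorem measurable_kern : Measurable kern :=
  (measurable_abs_im.pow_const _).ennreal_ofReal

theorem lintegral_kern_near {r : ℝ} (hr : 0 < r) :
    ∫⁻ c in {c : Circle | |(c : ℂ).im| ≤ r}, kern c ∂σ ≤
      ENNReal.ofReal (4 * Real.pi * r ^ (1 / 2 : ℝ)) := by
  set φ : ℝ → ℝ≥0∞ := (Set.Iic r).indicator fun u => ENNReal.ofReal (u ^ (-(1 / 2) : ℝ)) with hφ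
  have hm : Measurable φ :=
    ((measurable_id.pow_const _).ennreal_ofReal).indicator measurableSet_Iic
  have hanti : AntitoneOn φ (Set.Ioi 0) := by
    intro u hu v hv huv
    simp only [hφ, Set.indicator, Set.mem_Iic]
    by_cases h : v ≤ r
    · rw [if_pos h, if_pos (huv.trans h)]
      exact ENNReal.ofReal_le_ofReal (Real.rpow_le_rpow_of_nonpos hu huv (by norm_num))
    · rw [if_neg h]; exact zero_le
  have h1 := lintegral_abs_im_le hanti hm
  rw [← lintegral_indicator (measurableSet_le measurable_abs_im measurable_const)]
  refine h1.trans' (lintegral_mono fun c => ?_) |>.trans ?_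
  · simp only [hφ, Set.indicator, Set.mem_ofPred_eq, Set.mem_Iic, kern]; rfl
  · rw [hφ, lintegral_indicator measurableSet_Iic, Measure.restrict_restrict measurableSet_Iic,
      Set.Iic_inter_Ioi, ← ofReal_integral_eq_lintegral_ofReal]
    · rw [← intervalIntegral.integral_of_le hr.le, integral_rpow (.inl (by norm_num)),
        ← ENNReal.ofReal_mul (by positivity)]
      apply ENNReal.ofReal_le_ofReal
      rw [Real.zero_rpow (by norm_num)]
      norm_num
      ring_nf
      rfl
    · have := (intervalIntegral.intervalIntegrable_rpow' (a := 0) (b := r) (r := -(1 / 2))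
        (by norm_num))
      exact (intervalIntegrable_iff_integrableOn_Ioc_of_le hr.le).1 this
    · exact (ae_restrict_iff' measurableSet_Ioc).2
        (.of_forall fun x hx => Real.rpow_nonneg hx.1.le _)

theorem lintegral_kern_far {r : ℝ} (hr : 0 < r) :
    ∫⁻ c in {c : Circle | |(c : ℂ).im| ≤ r}ᶜ, kern c ^ (4 : ℝ) ∂σ ≤
      ENNReal.ofReal (4 * Real.pi * r⁻¹) := by
  -- Freezing the value below `r` keeps `φ` antitone on the half-line and costs only a second `r⁻¹`.
  set φ : ℝ → ℝ≥0∞ := fun u => ENNReal.ofReal ((max u r) ^ (-2 : ℝ)) with hφ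
  have hm : Measurable φ := ((measurable_id.max measurable_const).pow_const _).ennreal_ofReal
  have hanti : AntitoneOn φ (Set.Ioi 0) := by
    intro u hu v hv huv
    exact ENNReal.ofReal_le_ofReal (Real.rpow_le_rpow_of_nonpos (lt_max_of_lt_right hr)
      (max_le_max_right r huv) (by norm_num))
  have h1 := lintegral_abs_im_le hanti hm
  rw [← lintegral_indicator (measurableSet_le measurable_abs_im measurable_const).compl]
  refine h1.trans' (lintegral_mono fun c => ?_) |>.trans ?_
  · simp only [hφ, Set.indicator, Set.mem_ofPred_eq, Set.mem_compl_iff, kern]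
    by_cases h : |(c : ℂ).im| ≤ r
    · simp [h]
    · simp only [h, not_false_eq_true, if_true]
      push Not at h
      have h0 : 0 < |(c : ℂ).im| := hr.trans h
      rw [ENNReal.ofReal_rpow_of_nonneg (by positivity) (by norm_num), max_eq_left h.le,
        ← Real.rpow_mul h0.le]
      norm_num
  · rw [← Set.Ioc_union_Ioi_eq_Ioi hr.le, lintegral_union measurableSet_Ioi
      Set.Ioc_disjoint_Ioi_same]
    have e1 : ∫⁻ u in Set.Ioc 0 r, φ u = ENNReal.ofReal r⁻¹ := by
      rw [setLIntegral_congr_fun (g := fun _ => ENNReal.ofReal (r ^ (-2 : ℝ))) measurableSet_Ioc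
        (fun u hu => by simp only [hφ]; rw [max_eq_right hu.2])]
      rw [setLIntegral_const, Real.volume_Ioc, ← ENNReal.ofReal_mul (by positivity)]
      congr 1
      rw [sub_zero, Real.rpow_neg hr.le]
      norm_num
      field_simp
    have e2 : ∫⁻ u in Set.Ioi r, φ u = ENNReal.ofReal r⁻¹ := by
      rw [setLIntegral_congr_fun (g := fun u => ENNReal.ofReal (u ^ (-2 : ℝ))) measurableSet_Ioi
        (fun u hu => by simp only [hφ]; rw [max_eq_left (le_of_lt hu)])]
      rw [← ofReal_integral_eq_lintegral_ofReal (integrableOn_Ioi_rpow_of_lt (by norm_num) hr),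
        integral_Ioi_rpow_of_lt (by norm_num) hr]
      · congr 1
        norm_num
        rw [Real.rpow_neg_one]
      · exact (ae_restrict_iff' measurableSet_Ioi).2
          (.of_forall fun x hx => Real.rpow_nonneg (hr.trans hx).le _)
    rw [e1, e2, ← ENNReal.ofReal_add (by positivity) (by positivity),
      ← ENNReal.ofReal_mul (by positivity)]
    exact ENNReal.ofReal_le_ofReal (by ring_nf; rfl)

theorem kern_inv (c : Circle) : kern c⁻¹ = kern c := by
  simp [kern]

/-- The constant in the bilinear fractional integration inequality for the kernel `kern`. -/
noncomputable def hlsConst : ℝ≥0∞ :=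
  ENNReal.ofReal (4 * Real.pi) + ENNReal.ofReal (4 * Real.pi) ^ (1 / 4 : ℝ)

theorem hlsConst_ne_top : hlsConst ≠ ∞ :=
  ENNReal.add_ne_top.2 ⟨ENNReal.ofReal_ne_top,
    ENNReal.rpow_ne_top_of_nonneg (by norm_num) ENNReal.ofReal_ne_top⟩

/-- Near the singularity of the kernel the bound `g ≤ v` is used together with integrability of
`kern`; away from it, Hölder with exponents `4/3` and `4`, since `(g^(3/2))^(4/3) = g²`. -/
theorem lintegral_kern_le_of_bounded {g : Circle → ℝ≥0} (hg : Measurable g)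
    (hg1 : ∫⁻ b, (g b : ℝ≥0∞) ^ (2 : ℝ) ∂σ ≤ 1) {v : ℝ≥0} (hv : 0 < v) (a : Circle) :
    ∫⁻ b, {b | g b ≤ v}.indicator (fun b => (g b : ℝ≥0∞) ^ (3 / 2 : ℝ)) b * kern (a⁻¹ * b) ∂σ ≤
      hlsConst * (v : ℝ≥0∞) ^ (1 / 2 : ℝ) := by
  -- This cut balances the two parts: `v^(3/2) r^(1/2) = r^(-1/4) = v^(1/2)`.
  set r : ℝ := ((v : ℝ) ^ (2 : ℝ))⁻¹ with hr
  have hv' : (0 : ℝ) < v := hv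
  have hr0 : 0 < r := by positivity
  set S : Set Circle := {c : Circle | |(c : ℂ).im| ≤ r} with hS
  have hSm : MeasurableSet S := measurableSet_le measurable_abs_im measurable_const
  have hgm : Measurable fun b => (g b : ℝ≥0∞) ^ (3 / 2 : ℝ) := hg.coe_nnreal_ennreal.pow_const _
  have htr : Measurable fun b : Circle => a⁻¹ * b := measurable_const_mul _
  have hk1 : Measurable fun b => S.indicator kern (a⁻¹ * b) :=
    (measurable_kern.indicator hSm).comp htr
  have hk2 : Measurable fun b => Sᶜ.indicator kern (a⁻¹ * b) :=
    (measurable_kern.indicator hSm.compl).comp htr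
  have hpt : ∀ b, {b | g b ≤ v}.indicator (fun b => (g b : ℝ≥0∞) ^ (3 / 2 : ℝ)) b *
      kern (a⁻¹ * b) ≤ (v : ℝ≥0∞) ^ (3 / 2 : ℝ) * S.indicator kern (a⁻¹ * b) +
        (g b : ℝ≥0∞) ^ (3 / 2 : ℝ) * Sᶜ.indicator kern (a⁻¹ * b) := by
    intro b
    by_cases hb : g b ≤ v
    · have h1 : (g b : ℝ≥0∞) ≤ v := by exact_mod_cast hb
      by_cases hs : a⁻¹ * b ∈ S
      · simp only [Set.indicator, Set.mem_ofPred_eq, hb, if_true, hs, Set.mem_compl_iff,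
          not_true_eq_false, if_false, mul_zero, add_zero]
        gcongr
      · simp only [Set.indicator, Set.mem_ofPred_eq, hb, if_true, hs, Set.mem_compl_iff,
          not_false_eq_true, if_false, mul_zero, zero_add, le_refl]
    · simp [Set.indicator, hb]
  refine (lintegral_mono hpt).trans ?_
  rw [lintegral_add_left (hk1.const_mul _), lintegral_const_mul _ hk1]
  rw [hlsConst, add_mul]
  refine add_le_add ?_ ?_
  · rw [lintegral_mul_left_eq_self (S.indicator kern) a⁻¹, lintegral_indicator hSm]
    refine (mul_le_mul_right (lintegral_kern_near hr0) _).trans ?_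
    rw [← ENNReal.ofReal_coe_nnreal, ENNReal.ofReal_rpow_of_pos hv', ENNReal.ofReal_rpow_of_pos hv',
      ← ENNReal.ofReal_mul (by positivity), ← ENNReal.ofReal_mul (by positivity)]
    apply ENNReal.ofReal_le_ofReal
    have e1 : r ^ (1 / 2 : ℝ) = (v : ℝ) ^ (-1 : ℝ) := by
      rw [hr, ← Real.rpow_neg hv'.le, ← Real.rpow_mul hv'.le]; norm_num
    rw [e1, mul_left_comm, ← Real.rpow_add hv']
    norm_num
  · have hH := ENNReal.lintegral_mul_le_Lp_mul_Lq σ (p := 4 / 3) (q := 4)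
      (Real.holderConjugate_iff.2 ⟨by norm_num, by norm_num⟩) hgm.aemeasurable hk2.aemeasurable
    refine hH.trans ?_
    have e1 : ∫⁻ b, ((g b : ℝ≥0∞) ^ (3 / 2 : ℝ)) ^ (4 / 3 : ℝ) ∂σ ≤ 1 := by
      refine le_trans (le_of_eq (lintegral_congr fun b => ?_)) hg1
      rw [← ENNReal.rpow_mul]; norm_num
    have e2 : ∫⁻ b, (Sᶜ.indicator kern (a⁻¹ * b)) ^ (4 : ℝ) ∂σ ≤
        ENNReal.ofReal (4 * Real.pi * r⁻¹) := by
      rw [lintegral_mul_left_eq_self (fun c => (Sᶜ.indicator kern c) ^ (4 : ℝ)) a⁻¹]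
      refine le_trans (le_of_eq ?_) (lintegral_kern_far hr0)
      rw [← lintegral_indicator hSm.compl]
      refine lintegral_congr fun c => ?_
      by_cases hc : c ∈ S <;> simp [Set.indicator, hS]
    calc _ ≤ (1 : ℝ≥0∞) ^ (1 / (4 / 3) : ℝ) *
          (ENNReal.ofReal (4 * Real.pi * r⁻¹)) ^ (1 / 4 : ℝ) := by gcongr
      _ = _ := by
        rw [ENNReal.one_rpow, one_mul, ENNReal.ofReal_mul (by positivity),
          ENNReal.mul_rpow_of_nonneg _ _ (by norm_num), hr, inv_inv,
          ← ENNReal.ofReal_rpow_of_pos hv', ENNReal.ofReal_coe_nnreal, ← ENNReal.rpow_mul]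
        norm_num

/-- Split according to which of `f a`, `g b` is larger. Where `g b ≤ f a`, the inner integral is at
most a constant times `(f a)^(1/2)`, and `f^(3/2) f^(1/2) = f²` is integrable. The other region is
the same with the roles exchanged, because `kern` is invariant under inversion. -/
theorem lintegral_lintegral_kern_le_one {f g : Circle → ℝ≥0} (hf : Measurable f)
    (hg : Measurable g) (hf1 : ∫⁻ b, (f b : ℝ≥0∞) ^ (2 : ℝ) ∂σ ≤ 1)
    (hg1 : ∫⁻ b, (g b : ℝ≥0∞) ^ (2 : ℝ) ∂σ ≤ 1) :
    ∫⁻ a, ∫⁻ b, (f a : ℝ≥0∞) ^ (3 / 2 : ℝ) * (g b : ℝ≥0∞) ^ (3 / 2 : ℝ) * kern (a⁻¹ * b) ∂σ ∂σ ≤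
      2 * hlsConst := by
  have half : ∀ {f g : Circle → ℝ≥0}, Measurable f → Measurable g →
      ∫⁻ b, (f b : ℝ≥0∞) ^ (2 : ℝ) ∂σ ≤ 1 → ∫⁻ b, (g b : ℝ≥0∞) ^ (2 : ℝ) ∂σ ≤ 1 →
      ∫⁻ a, ∫⁻ b, (f a : ℝ≥0∞) ^ (3 / 2 : ℝ) *
        ({b | g b ≤ f a}.indicator (fun b => (g b : ℝ≥0∞) ^ (3 / 2 : ℝ)) b * kern (a⁻¹ * b)) ∂σ ∂σ ≤
      hlsConst := by
    intro f g hf hg hf1 hg1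
    calc _ ≤ ∫⁻ a, hlsConst * (f a : ℝ≥0∞) ^ (2 : ℝ) ∂σ := by
          refine lintegral_mono fun a => ?_
          simp only
          rw [lintegral_const_mul' _ _
            (ENNReal.rpow_ne_top_of_nonneg (by norm_num) ENNReal.coe_ne_top)]
          rcases eq_or_lt_of_le (zero_le (a := f a)) with h | h
          · rw [← h, ENNReal.coe_zero, ENNReal.zero_rpow_of_pos (by norm_num), zero_mul]
            exact zero_le
          · refine (mul_le_mul_right (lintegral_kern_le_of_bounded hg hg1 h a) _).trans ?_
            rw [mul_left_comm, ← ENNReal.rpow_add _ _ (by simpa using h.ne') (by simp)]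
            norm_num
      _ ≤ hlsConst * 1 := by
          rw [lintegral_const_mul _ (hf.coe_nnreal_ennreal.pow_const _)]
          gcongr
      _ = _ := mul_one _
  have hpt : ∀ a b, (f a : ℝ≥0∞) ^ (3 / 2 : ℝ) * (g b : ℝ≥0∞) ^ (3 / 2 : ℝ) * kern (a⁻¹ * b) ≤
      (f a : ℝ≥0∞) ^ (3 / 2 : ℝ) *
        ({b | g b ≤ f a}.indicator (fun b => (g b : ℝ≥0∞) ^ (3 / 2 : ℝ)) b * kern (a⁻¹ * b)) +
      (g b : ℝ≥0∞) ^ (3 / 2 : ℝ) *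
        ({a | f a ≤ g b}.indicator (fun a => (f a : ℝ≥0∞) ^ (3 / 2 : ℝ)) a * kern (b⁻¹ * a)) := by
    intro a b
    rcases le_total (g b) (f a) with h | h
    · refine le_trans (le_of_eq ?_) le_self_add
      simp [Set.indicator, h, mul_assoc]
    · refine le_trans (le_of_eq ?_) le_add_self
      rw [← kern_inv (b⁻¹ * a)]
      simp [Set.indicator, h]
      ring
  have hm : ∀ {f g : Circle → ℝ≥0}, Measurable f → Measurable g →
      Measurable fun p : Circle × Circle => (f p.1 : ℝ≥0∞) ^ (3 / 2 : ℝ) *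
        ({b | g b ≤ f p.1}.indicator (fun b => (g b : ℝ≥0∞) ^ (3 / 2 : ℝ)) p.2 *
          kern (p.1⁻¹ * p.2)) := by
    intro f g hf hg
    have h1 : Measurable fun p : Circle × Circle => (f p.1 : ℝ≥0∞) ^ (3 / 2 : ℝ) :=
      ((hf.comp measurable_fst).coe_nnreal_ennreal.pow_const _)
    have h2 : Measurable fun p : Circle × Circle => (g p.2 : ℝ≥0∞) ^ (3 / 2 : ℝ) :=
      ((hg.comp measurable_snd).coe_nnreal_ennreal.pow_const _)
    have h3 : MeasurableSet {p : Circle × Circle | g p.2 ≤ f p.1} :=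
      measurableSet_le (hg.comp measurable_snd) (hf.comp measurable_fst)
    exact h1.mul ((h2.indicator h3).mul
      (measurable_kern.comp (measurable_fst.inv.mul measurable_snd)))
  calc _ ≤ ∫⁻ a, ∫⁻ b, _ + _ ∂σ ∂σ := lintegral_mono fun a => lintegral_mono fun b => hpt a b
    _ = ∫⁻ a, ∫⁻ b, (f a : ℝ≥0∞) ^ (3 / 2 : ℝ) *
        ({b | g b ≤ f a}.indicator (fun b => (g b : ℝ≥0∞) ^ (3 / 2 : ℝ)) b * kern (a⁻¹ * b)) ∂σ ∂σ +
        ∫⁻ a, ∫⁻ b, (g b : ℝ≥0∞) ^ (3 / 2 : ℝ) *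
        ({a | f a ≤ g b}.indicator (fun a => (f a : ℝ≥0∞) ^ (3 / 2 : ℝ)) a * kern (b⁻¹ * a)) ∂σ ∂σ := by
      rw [← lintegral_add_left (hm hf hg).lintegral_prod_right']
      refine lintegral_congr fun a => ?_
      rw [lintegral_add_left]
      exact (hm hf hg).comp measurable_prodMk_left
    _ ≤ hlsConst + hlsConst := by
      gcongr
      · exact half hf hg hf1 hg1
      · rw [lintegral_lintegral_swap]
        · exact half hg hf hg1 hf1
        · exact ((hm hg hf).comp measurable_swap).aemeasurable
    _ = _ := (two_mul _).symm

theorem lintegral_rpow_ne_top_normalize {f : Circle → ℝ≥0} (hf : Measurable f) {F : ℝ≥0}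
    (hF : F ≠ 0) (h : ∫⁻ b, (f b : ℝ≥0∞) ^ (2 : ℝ) ∂σ = (F : ℝ≥0∞) ^ (2 : ℝ)) :
    ∫⁻ b, ((F⁻¹ * f b : ℝ≥0) : ℝ≥0∞) ^ (2 : ℝ) ∂σ ≤ 1 := by
  have : ∀ b, ((F⁻¹ * f b : ℝ≥0) : ℝ≥0∞) ^ (2 : ℝ) =
      ((F⁻¹ : ℝ≥0) : ℝ≥0∞) ^ (2 : ℝ) * (f b : ℝ≥0∞) ^ (2 : ℝ) := fun b => by
    rw [ENNReal.coe_mul, ENNReal.mul_rpow_of_nonneg _ _ (by norm_num)]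
  simp_rw [this]
  rw [lintegral_const_mul _ (hf.coe_nnreal_ennreal.pow_const _), h,
    ← ENNReal.mul_rpow_of_nonneg _ _ (by norm_num), ← ENNReal.coe_mul, inv_mul_cancel₀ hF]
  simp

/-- Bilinear fractional integration on the circle. -/
theorem lintegral_lintegral_kern_le {f g : Circle → ℝ≥0} (hf : Measurable f)
    (hg : Measurable g) (hf1 : ∫⁻ b, (f b : ℝ≥0∞) ^ (2 : ℝ) ∂σ ≠ ∞)
    (hg1 : ∫⁻ b, (g b : ℝ≥0∞) ^ (2 : ℝ) ∂σ ≠ ∞) :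
    ∫⁻ a, ∫⁻ b, (f a : ℝ≥0∞) ^ (3 / 2 : ℝ) * (g b : ℝ≥0∞) ^ (3 / 2 : ℝ) * kern (a⁻¹ * b) ∂σ ∂σ ≤
      2 * hlsConst * ((∫⁻ b, (f b : ℝ≥0∞) ^ (2 : ℝ) ∂σ) ^ (3 / 4 : ℝ) *
        (∫⁻ b, (g b : ℝ≥0∞) ^ (2 : ℝ) ∂σ) ^ (3 / 4 : ℝ)) := by
  have hzero : ∀ {f : Circle → ℝ≥0}, Measurable f → ∫⁻ b, (f b : ℝ≥0∞) ^ (2 : ℝ) ∂σ = 0 →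
      ∀ᵐ b ∂σ, f b = 0 := by
    intro f hf h
    rw [lintegral_eq_zero_iff (hf.coe_nnreal_ennreal.pow_const _)] at h
    filter_upwards [h] with b hb
    simpa using hb
  have hroot : ∀ {f : Circle → ℝ≥0}, ∫⁻ b, (f b : ℝ≥0∞) ^ (2 : ℝ) ∂σ ≠ ∞ →
      ∫⁻ b, (f b : ℝ≥0∞) ^ (2 : ℝ) ∂σ ≠ 0 →
      ∃ F : ℝ≥0, F ≠ 0 ∧ ∫⁻ b, (f b : ℝ≥0∞) ^ (2 : ℝ) ∂σ = (F : ℝ≥0∞) ^ (2 : ℝ) := by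
    intro f h h0
    refine ⟨((∫⁻ b, (f b : ℝ≥0∞) ^ (2 : ℝ) ∂σ) ^ (1 / 2 : ℝ)).toNNReal, ?_, ?_⟩
    · rw [Ne, ENNReal.toNNReal_eq_zero_iff, ENNReal.rpow_eq_zero_iff, ENNReal.rpow_eq_top_iff]
      simp only [h0, h, false_and, or_self, not_false_eq_true]
    · rw [ENNReal.coe_toNNReal (ENNReal.rpow_ne_top_of_nonneg (by norm_num) h), ← ENNReal.rpow_mul]; norm_num
  by_cases hf0 : ∫⁻ b, (f b : ℝ≥0∞) ^ (2 : ℝ) ∂σ = 0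
  · refine le_trans (le_of_eq ?_) zero_le
    rw [lintegral_congr_ae (g := fun _ => 0), lintegral_zero]
    filter_upwards [hzero hf hf0] with a ha
    simp [ha]
  by_cases hg0 : ∫⁻ b, (g b : ℝ≥0∞) ^ (2 : ℝ) ∂σ = 0
  · refine le_trans (le_of_eq ?_) zero_le
    rw [lintegral_congr (g := fun _ => 0), lintegral_zero]
    intro a
    rw [lintegral_congr_ae (g := fun _ => 0), lintegral_zero]
    filter_upwards [hzero hg hg0] with b hb
    simp [hb]
  obtain ⟨F, hF, hF2⟩ := hroot hf1 hf0
  obtain ⟨G, hG, hG2⟩ := hroot hg1 hg0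
  have h := lintegral_lintegral_kern_le_one (hf.const_mul F⁻¹) (hg.const_mul G⁻¹)
    (lintegral_rpow_ne_top_normalize hf hF hF2) (lintegral_rpow_ne_top_normalize hg hG hG2)
  have hm : Measurable fun p : Circle × Circle =>
      ((F⁻¹ * f p.1 : ℝ≥0) : ℝ≥0∞) ^ (3 / 2 : ℝ) * ((G⁻¹ * g p.2 : ℝ≥0) : ℝ≥0∞) ^ (3 / 2 : ℝ) *
        kern (p.1⁻¹ * p.2) :=
    ((((hf.comp measurable_fst).const_mul _).coe_nnreal_ennreal.pow_const _).mul
      (((hg.comp measurable_snd).const_mul _).coe_nnreal_ennreal.pow_const _)).mul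
      (measurable_kern.comp (measurable_fst.inv.mul measurable_snd))
  have hpt : ∀ a b, (f a : ℝ≥0∞) ^ (3 / 2 : ℝ) * (g b : ℝ≥0∞) ^ (3 / 2 : ℝ) * kern (a⁻¹ * b) =
      (F : ℝ≥0∞) ^ (3 / 2 : ℝ) * (G : ℝ≥0∞) ^ (3 / 2 : ℝ) *
      (((F⁻¹ * f a : ℝ≥0) : ℝ≥0∞) ^ (3 / 2 : ℝ) * ((G⁻¹ * g b : ℝ≥0) : ℝ≥0∞) ^ (3 / 2 : ℝ) *
        kern (a⁻¹ * b)) := by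
    intro a b
    have e1 : (f a : ℝ≥0∞) = F * ((F⁻¹ * f a : ℝ≥0) : ℝ≥0∞) := by
      rw [← ENNReal.coe_mul, mul_inv_cancel_left₀ hF]
    have e2 : (g b : ℝ≥0∞) = G * ((G⁻¹ * g b : ℝ≥0) : ℝ≥0∞) := by
      rw [← ENNReal.coe_mul, mul_inv_cancel_left₀ hG]
    rw [e1, e2, ENNReal.mul_rpow_of_nonneg _ _ (by norm_num),
      ENNReal.mul_rpow_of_nonneg _ _ (by norm_num)]
    ring
  simp_rw [hpt]
  calc _ = (F : ℝ≥0∞) ^ (3 / 2 : ℝ) * (G : ℝ≥0∞) ^ (3 / 2 : ℝ) *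
      ∫⁻ a, ∫⁻ b, (((F⁻¹ * f a : ℝ≥0) : ℝ≥0∞) ^ (3 / 2 : ℝ) *
        ((G⁻¹ * g b : ℝ≥0) : ℝ≥0∞) ^ (3 / 2 : ℝ) * kern (a⁻¹ * b)) ∂σ ∂σ := by
        rw [← lintegral_const_mul _ hm.lintegral_prod_right']
        refine lintegral_congr fun a => ?_
        exact lintegral_const_mul _ (hm.comp (measurable_prodMk_left (x := a)))
    _ ≤ (F : ℝ≥0∞) ^ (3 / 2 : ℝ) * (G : ℝ≥0∞) ^ (3 / 2 : ℝ) * (2 * hlsConst) := by gcongr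
    _ = _ := by
        rw [hF2, hG2, ← ENNReal.rpow_mul, ← ENNReal.rpow_mul]
        norm_num
        ring

/-! ### The density of `fσ ∗ gσ` and its bound in `L^{3/2}`. -/

/-- Lebesgue measure on the disc `‖z‖ < 2` with the density of one branch of `σ ∗ σ`. -/
noncomputable def branchMeasure : Measure ℂ :=
  volume.withDensity fun z => ENNReal.ofReal (weight z)

theorem measurable_branch : Measurable fun z => (sumFst z, sumSnd z) :=
  measurable_sumFst.prodMk measurable_sumSnd

theorem measurable_branch' : Measurable fun z => (sumSnd z, sumFst z) :=
  measurable_sumSnd.prodMk measurable_sumFst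

/-- The change of variables as an identity of measures, so that it also applies to complex-valued
integrands. -/
theorem prod_σ_eq : σ.prod σ = branchMeasure.map (fun z => (sumFst z, sumSnd z)) +
    branchMeasure.map (fun z => (sumSnd z, sumFst z)) := by
  ext s hs
  have hi : Measurable (s.indicator (1 : Circle × Circle → ℝ≥0∞)) := measurable_one.indicator hs
  have hw := measurable_weight.ennreal_ofReal
  rw [← lintegral_indicator_one hs, lintegral_prod_σ hi, Measure.add_apply,
    Measure.map_apply measurable_branch hs, Measure.map_apply measurable_branch' hs,
    branchMeasure, withDensity_apply _ (measurable_branch hs),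
    withDensity_apply _ (measurable_branch' hs),
    ← lintegral_indicator (measurable_branch hs), ← lintegral_indicator (measurable_branch' hs),
    ← lintegral_add_left (hw.indicator (measurable_branch hs))]
  refine lintegral_congr fun z => ?_
  by_cases h1 : (sumFst z, sumSnd z) ∈ s <;> by_cases h2 : (sumSnd z, sumFst z) ∈ s <;>
    simp [Set.indicator, h1, h2, mul_add]

/-- The density with respect to Lebesgue measure of the image under addition of `F d(σ × σ)`. -/
noncomputable def fold (F : Circle × Circle → ℂ) (z : ℂ) : ℂ :=
  (weight z : ℂ) * (F (sumFst z, sumSnd z) + F (sumSnd z, sumFst z))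

theorem measurable_fold {F : Circle × Circle → ℂ} (hF : Measurable F) : Measurable (fold F) :=
  (Complex.measurable_ofReal.comp measurable_weight).mul
    ((hF.comp measurable_branch).add (hF.comp measurable_branch'))

theorem integrable_fold_and_integral {F : Circle × Circle → ℂ} (hF : Integrable F (σ.prod σ)) :
    Integrable (fold F) ∧ ∫ p, F p ∂(σ.prod σ) = ∫ z, fold F z := by
  rw [prod_σ_eq] at hF ⊢
  have h1 := hF.left_of_add_measure
  have h2 := hF.right_of_add_measure
  have hw := measurable_weight.ennreal_ofReal
  have hlt : ∀ᵐ z : ℂ, ENNReal.ofReal (weight z) < ∞ := .of_forall fun z => by simp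
  have h1' := (integrable_map_measure h1.1 measurable_branch.aemeasurable).1 h1
  have h2' := (integrable_map_measure h2.1 measurable_branch'.aemeasurable).1 h2
  have e : ∀ (G : ℂ → ℂ) (z : ℂ), (ENNReal.ofReal (weight z)).toReal • G z = weight z * G z := by
    intro G z
    rw [ENNReal.toReal_ofReal (weight_nonneg z), Complex.real_smul]
  rw [branchMeasure, integrable_withDensity_iff_integrable_smul' hw hlt] at h1' h2'
  simp only [e] at h1' h2'
  have hf : fold F = (fun z => weight z * (F ∘ fun z => (sumFst z, sumSnd z)) z) +
      fun z => weight z * (F ∘ fun z => (sumSnd z, sumFst z)) z := by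
    ext z; simp [fold, mul_add]
  refine ⟨hf ▸ h1'.add h2', ?_⟩
  rw [integral_add_measure h1 h2, integral_map measurable_branch.aemeasurable h1.1,
    integral_map measurable_branch'.aemeasurable h2.1, branchMeasure,
    integral_withDensity_eq_integral_toReal_smul hw hlt,
    integral_withDensity_eq_integral_toReal_smul hw hlt, hf, integral_add' h1' h2']
  congr 1 <;> exact integral_congr_ae (.of_forall fun z => e (fun _ => F _) z)

/-- A function of the sum takes the same value on both preimages of `z`. Where `weight z = 0` both
sides vanish, so the identity holds at every point of the plane. -/
theorem fold_mul_comp_add (F : Circle × Circle → ℂ) (Ψ : ℂ → ℂ) (z : ℂ) :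
    fold (fun p => F p * Ψ (p.1 + p.2)) z = fold F z * Ψ z := by
  by_cases hz : weight z = 0
  · simp [fold, hz]
  · have h := sumFst_add_sumSnd (norm_lt_two_of_weight_ne_zero hz).le
    have h' : (sumSnd z : ℂ) + sumFst z = z := by rw [add_comm, h]
    simp only [fold, h, h']
    ring

/-- The density of `fσ ∗ gσ`. -/
noncomputable def density (f g : Circle → ℂ) : ℂ → ℂ := fold fun p => f p.1 * g p.2

theorem measurable_density {f g : Circle → ℂ} (hf : Measurable f) (hg : Measurable g) :
    Measurable (density f g) :=
  measurable_fold ((hf.comp measurable_fst).mul (hg.comp measurable_snd))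

theorem density_comm (f g : Circle → ℂ) : density f g = density g f := by
  ext z; simp only [density, fold]; ring

theorem density_sub_left (f₁ f₂ g : Circle → ℂ) (z : ℂ) :
    density (fun x => f₁ x - f₂ x) g z = density f₁ g z - density f₂ g z := by
  simp only [density, fold]; ring

theorem density_sub_right (f g₁ g₂ : Circle → ℂ) (z : ℂ) :
    density f (fun x => g₁ x - g₂ x) z = density f g₁ z - density f g₂ z := by
  simp only [density, fold]; ring

/-- At `z = 0` the argument is not equivariant under rotation, but `weight 0 = 0` because `sin π =
0`. -/
theorem density_mul (a : Circle) (f g : Circle → ℂ) (z : ℂ) :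
    density (fun x => f (a * x)) (fun x => g (a * x)) z = density f g (a * z) := by
  rcases eq_or_ne z 0 with rfl | hz
  · have : weight 0 = 0 := by
      simp [weight, mul_div_cancel₀]
    simp [density, fold, this]
  · simp only [density, fold, weight_exp_mul, sumFst_mul a hz, sumSnd_mul a hz]

/-- The constant in the bound for the density in `L^{3/2}`. -/
noncomputable def densityConst : ℝ≥0∞ := (4 * hlsConst) ^ (2 / 3 : ℝ)

theorem densityConst_ne_top : densityConst ≠ ∞ :=
  ENNReal.rpow_ne_top_of_nonneg (by norm_num)
    (ENNReal.mul_ne_top (by norm_num) hlsConst_ne_top)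

theorem kern_branch {z : ℂ} : ENNReal.ofReal (weight z) ^ (1 / 2 : ℝ) ≤
    kern ((sumFst z)⁻¹ * sumSnd z) := by
  have h0 := weight_nonneg z
  rcases h0.eq_or_lt with h | h
  · rw [← h, ENNReal.ofReal_zero, ENNReal.zero_rpow_of_pos (by norm_num)]; exact zero_le
  have e1 : (sumFst z)⁻¹ * sumSnd z = Circle.exp (-(2 * Real.arccos (‖z‖ / 2))) := by
    rw [sumFst, sumSnd, mul_inv, mul_mul_mul_comm, inv_mul_cancel, one_mul, ← Circle.exp_neg,
      ← Circle.exp_add]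
    congr 1; ring
  rw [e1, kern, Circle.coe_exp, Complex.exp_ofReal_mul_I_im, Real.sin_neg, abs_neg]
  have h2 : 0 < Real.sin (2 * Real.arccos (‖z‖ / 2)) := inv_pos.1 h
  rw [abs_of_pos h2, ENNReal.ofReal_rpow_of_pos h, weight, Real.rpow_neg h2.le,
    Real.inv_rpow h2.le]

/-- In `weight^(3/2) = weight · weight^(1/2)` the first factor is the Jacobian that turns the plane
integral into an integral over the torus, and the second is dominated by `kern`. What remains is the
bilinear fractional integral of `|f|^(3/2)` and `|g|^(3/2)`. -/
theorem lintegral_density_le {f g : Circle → ℂ} (hf : Measurable f) (hg : Measurable g)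
    (hf1 : ∫⁻ b, ‖f b‖ₑ ^ (2 : ℝ) ∂σ ≠ ∞) (hg1 : ∫⁻ b, ‖g b‖ₑ ^ (2 : ℝ) ∂σ ≠ ∞) :
    ∫⁻ z, ‖density f g z‖ₑ ^ (3 / 2 : ℝ) ≤
      4 * hlsConst * ((∫⁻ b, ‖f b‖ₑ ^ (2 : ℝ) ∂σ) ^ (3 / 4 : ℝ) *
        (∫⁻ b, ‖g b‖ₑ ^ (2 : ℝ) ∂σ) ^ (3 / 4 : ℝ)) := by
  -- The factor `2` bounds the constant `2^(1/2)` in `(x + y)^(3/2) ≤ 2^(1/2) (x^(3/2) + y^(3/2))`,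
  -- applied to the two branches.
  set G : Circle × Circle → ℝ≥0∞ := fun p =>
    2 * (‖f p.1‖ₑ ^ (3 / 2 : ℝ) * ‖g p.2‖ₑ ^ (3 / 2 : ℝ) * kern (p.1⁻¹ * p.2)) with hG
  have hGm : Measurable G := (((((hf.comp measurable_fst).enorm.pow_const _).mul
    ((hg.comp measurable_snd).enorm.pow_const _)).mul
    (measurable_kern.comp (measurable_fst.inv.mul measurable_snd)))).const_mul 2
  have hpt : ∀ z, ‖density f g z‖ₑ ^ (3 / 2 : ℝ) ≤
      ENNReal.ofReal (weight z) * (G (sumFst z, sumSnd z) + G (sumSnd z, sumFst z)) := by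
    intro z
    set W := ENNReal.ofReal (weight z) with hW
    have e1 : ‖density f g z‖ₑ ≤ W * (‖f (sumFst z)‖ₑ * ‖g (sumSnd z)‖ₑ +
        ‖f (sumSnd z)‖ₑ * ‖g (sumFst z)‖ₑ) := by
      rw [density, fold, enorm_mul]
      have : ‖(weight z : ℂ)‖ₑ = W := by
        rw [← ofReal_norm, Complex.norm_real, Real.norm_of_nonneg (weight_nonneg z)]
      rw [this]
      gcongr
      refine (enorm_add_le _ _).trans ?_
      rw [enorm_mul, enorm_mul]
    have e2 : W ^ (3 / 2 : ℝ) = W * W ^ (1 / 2 : ℝ) := by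
      rw [show (3 / 2 : ℝ) = 1 + 1 / 2 by norm_num, ENNReal.rpow_add_of_nonneg _ _ (by norm_num)
        (by norm_num), ENNReal.rpow_one]
    have e3 : kern ((sumSnd z)⁻¹ * sumFst z) = kern ((sumFst z)⁻¹ * sumSnd z) := by
      rw [← kern_inv]; simp
    have e4 : (2 : ℝ≥0∞) ^ (3 / 2 - 1 : ℝ) ≤ 2 := by
      nth_rewrite 2 [← ENNReal.rpow_one 2]
      exact ENNReal.rpow_le_rpow_of_exponent_le (by norm_num) (by norm_num)
    calc _ ≤ (W * (‖f (sumFst z)‖ₑ * ‖g (sumSnd z)‖ₑ +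
        ‖f (sumSnd z)‖ₑ * ‖g (sumFst z)‖ₑ)) ^ (3 / 2 : ℝ) := by gcongr
      _ = W * (W ^ (1 / 2 : ℝ) * (‖f (sumFst z)‖ₑ * ‖g (sumSnd z)‖ₑ +
        ‖f (sumSnd z)‖ₑ * ‖g (sumFst z)‖ₑ) ^ (3 / 2 : ℝ)) := by
          rw [ENNReal.mul_rpow_of_nonneg _ _ (by norm_num), e2, mul_assoc]
      _ ≤ W * (kern ((sumFst z)⁻¹ * sumSnd z) * (2 * ((‖f (sumFst z)‖ₑ * ‖g (sumSnd z)‖ₑ) ^ (3 / 2 : ℝ) +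
        (‖f (sumSnd z)‖ₑ * ‖g (sumFst z)‖ₑ) ^ (3 / 2 : ℝ)))) := by
          gcongr
          · exact kern_branch
          · exact (ENNReal.rpow_add_le_mul_rpow_add_rpow _ _ (by norm_num)).trans (by gcongr)
      _ = _ := by
          simp only [hG, e3]
          rw [ENNReal.mul_rpow_of_nonneg _ _ (by norm_num),
            ENNReal.mul_rpow_of_nonneg _ _ (by norm_num)]
          ring
  refine (lintegral_mono hpt).trans ?_
  rw [← lintegral_prod_σ hGm, lintegral_prod _ hGm.aemeasurable]
  have h := lintegral_lintegral_kern_le hf.nnnorm hg.nnnorm hf1 hg1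
  have e : ∫⁻ a, ∫⁻ b, G (a, b) ∂σ ∂σ = 2 * ∫⁻ a, ∫⁻ b, ‖f a‖ₑ ^ (3 / 2 : ℝ) *
      ‖g b‖ₑ ^ (3 / 2 : ℝ) * kern (a⁻¹ * b) ∂σ ∂σ := by
    simp only [hG]
    simp_rw [lintegral_const_mul' 2 _ (by norm_num)]
  rw [e]
  calc _ ≤ 2 * (2 * hlsConst * ((∫⁻ b, ‖f b‖ₑ ^ (2 : ℝ) ∂σ) ^ (3 / 4 : ℝ) *
        (∫⁻ b, ‖g b‖ₑ ^ (2 : ℝ) ∂σ) ^ (3 / 4 : ℝ))) := by gcongr; exact h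
    _ = _ := by ring

theorem toReal_three_halves : ((3 / 2 : ℝ≥0∞)).toReal = 3 / 2 := by simp

theorem three_halves_ne_top : (3 / 2 : ℝ≥0∞) ≠ ∞ :=
  ENNReal.div_ne_top (by norm_num) (by norm_num)

theorem eLpNorm_three_halves (P : ℂ → ℂ) :
    eLpNorm P (3 / 2) volume = (∫⁻ z, ‖P z‖ₑ ^ (3 / 2 : ℝ)) ^ (2 / 3 : ℝ) := by
  rw [eLpNorm_eq_lintegral_rpow_enorm_toReal (by simp) three_halves_ne_top,
    toReal_three_halves]
  norm_num

theorem eLpNorm_two (f : Circle → ℂ) :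
    eLpNorm f 2 σ = (∫⁻ b, ‖f b‖ₑ ^ (2 : ℝ) ∂σ) ^ (1 / 2 : ℝ) := by
  rw [eLpNorm_eq_lintegral_rpow_enorm_toReal (by simp) (by simp)]
  simp

theorem lintegral_sq_ne_top {f : Circle → ℂ} (hf : MemLp f 2 σ) :
    ∫⁻ b, ‖f b‖ₑ ^ (2 : ℝ) ∂σ ≠ ∞ := by
  intro h
  have := hf.2
  rw [eLpNorm_two, h, ENNReal.top_rpow_of_pos (by norm_num)] at this
  exact this.ne rfl

/-- `fσ ∗ gσ` is in `L^{3/2}` for `f, g` in `L²`. -/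
theorem eLpNorm_density_le {f g : Circle → ℂ} (hf : Measurable f) (hg : Measurable g)
    (hf2 : MemLp f 2 σ) (hg2 : MemLp g 2 σ) :
    eLpNorm (density f g) (3 / 2) volume ≤
      densityConst * (eLpNorm f 2 σ * eLpNorm g 2 σ) := by
  rw [eLpNorm_three_halves, eLpNorm_two, eLpNorm_two, densityConst]
  refine (ENNReal.rpow_le_rpow (lintegral_density_le hf hg (lintegral_sq_ne_top hf2)
    (lintegral_sq_ne_top hg2)) (by norm_num)).trans (le_of_eq ?_)
  rw [ENNReal.mul_rpow_of_nonneg _ _ (by norm_num), ENNReal.mul_rpow_of_nonneg _ _ (by norm_num),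
    ENNReal.mul_rpow_of_nonneg _ _ (by norm_num), ← ENNReal.rpow_mul, ← ENNReal.rpow_mul]
  norm_num

theorem memLp_density {f g : Circle → ℂ} (hf : Measurable f) (hg : Measurable g)
    (hf2 : MemLp f 2 σ) (hg2 : MemLp g 2 σ) : MemLp (density f g) (3 / 2) volume :=
  ⟨(measurable_density hf hg).aestronglyMeasurable,
    (eLpNorm_density_le hf hg hf2 hg2).trans_lt (ENNReal.mul_lt_top densityConst_ne_top.lt_top
      (ENNReal.mul_lt_top hf2.2 hg2.2))⟩

/-! ### The symmetric trilinear form on `L^{3/2}`. -/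

/-- Young's inequality for the trilinear form `∫∫ u(z) v(w) k(-z-w)` at the symmetric exponent. -/
theorem lintegral_trilinear_le {u v k : ℂ → ℝ≥0∞} (hu : Measurable u) (hv : Measurable v)
    (hk : Measurable k) :
    ∫⁻ p : ℂ × ℂ, u p.1 * v p.2 * k (-p.1 - p.2) ≤
      (∫⁻ z, u z ^ (3 / 2 : ℝ)) ^ (2 / 3 : ℝ) * (∫⁻ z, v z ^ (3 / 2 : ℝ)) ^ (2 / 3 : ℝ) *
        (∫⁻ z, k z ^ (3 / 2 : ℝ)) ^ (2 / 3 : ℝ) := by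
  set U := fun z => u z ^ (3 / 2 : ℝ) with hU
  set V := fun z => v z ^ (3 / 2 : ℝ) with hV
  set K := fun z => k z ^ (3 / 2 : ℝ) with hK
  have hUm : Measurable U := hu.pow_const _
  have hVm : Measurable V := hv.pow_const _
  have hKm : Measurable K := hk.pow_const _
  have hs : Measurable fun p : ℂ × ℂ => -p.1 - p.2 := by fun_prop
  -- Hölder with three exponents `1/3` applied to `u v k = (U V)^(1/3) (U K)^(1/3) (V K)^(1/3)`.
  -- Each factor involves only two of the three functions, so its integral splits into a product
  -- after a translation.
  let F : Fin 3 → ℂ × ℂ → ℝ≥0∞ := ![fun p => U p.1 * V p.2, fun p => U p.1 * K (-p.1 - p.2),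
    fun p => V p.2 * K (-p.1 - p.2)]
  have hFm : ∀ i, Measurable (F i) := by
    intro i
    fin_cases i
    · exact (hUm.comp measurable_fst).mul (hVm.comp measurable_snd)
    · exact (hUm.comp measurable_fst).mul (hKm.comp hs)
    · exact (hVm.comp measurable_snd).mul (hKm.comp hs)
  have h := ENNReal.lintegral_prod_norm_pow_le (μ := (volume : Measure (ℂ × ℂ))) Finset.univ
    (f := F) (fun i _ => (hFm i).aemeasurable) (p := fun _ => 1 / 3) (by simp)
    (fun _ _ => by norm_num)
  simp only [Fin.prod_univ_three] at h
  have e0 : ∫⁻ p, F 0 p = (∫⁻ z, U z) * ∫⁻ z, V z := by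
    exact lintegral_prod_mul hUm.aemeasurable hVm.aemeasurable
  have e1 : ∫⁻ p, F 1 p = (∫⁻ z, U z) * ∫⁻ z, K z := by
    rw [Measure.volume_eq_prod, lintegral_prod _ (hFm 1).aemeasurable,
      ← lintegral_mul_const _ hUm]
    refine lintegral_congr fun z => ?_
    change ∫⁻ w, U z * K (-z - w) = _
    rw [lintegral_const_mul (f := fun w => K (-z - w)) _ (hKm.comp (by fun_prop)), lintegral_sub_left_eq_self K (-z)]
  have e2 : ∫⁻ p, F 2 p = (∫⁻ z, V z) * ∫⁻ z, K z := by
    rw [Measure.volume_eq_prod, lintegral_prod_symm _ (hFm 2).aemeasurable,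
      ← lintegral_mul_const _ hVm]
    refine lintegral_congr fun w => ?_
    change ∫⁻ z, V w * K (-z - w) = _
    rw [lintegral_const_mul (f := fun z => K (-z - w)) _ (hKm.comp (by fun_prop))]
    congr 1
    rw [← lintegral_sub_left_eq_self K (-w)]
    refine lintegral_congr fun z => by ring_nf
  rw [e0, e1, e2] at h
  have hroot : ∀ x : ℝ≥0∞, (x ^ (3 / 2 : ℝ)) ^ (1 / 3 : ℝ) * (x ^ (3 / 2 : ℝ)) ^ (1 / 3 : ℝ) = x := by
    intro x
    rw [← ENNReal.rpow_mul, ← ENNReal.rpow_add_of_nonneg _ _ (by norm_num) (by norm_num)]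
    norm_num
  have hpt : ∀ p : ℂ × ℂ, u p.1 * v p.2 * k (-p.1 - p.2) =
      F 0 p ^ (1 / 3 : ℝ) * F 1 p ^ (1 / 3 : ℝ) * F 2 p ^ (1 / 3 : ℝ) := by
    intro p
    change _ = (U p.1 * V p.2) ^ (1 / 3 : ℝ) * (U p.1 * K (-p.1 - p.2)) ^ (1 / 3 : ℝ) *
      (V p.2 * K (-p.1 - p.2)) ^ (1 / 3 : ℝ)
    simp only [ENNReal.mul_rpow_of_nonneg _ _ (show (0 : ℝ) ≤ 1 / 3 by norm_num)]
    conv_lhs => rw [← hroot (u p.1), ← hroot (v p.2), ← hroot (k (-p.1 - p.2))]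
    simp only [hU, hV, hK]
    ring
  simp_rw [hpt]
  refine h.trans (le_of_eq ?_)
  simp only [ENNReal.mul_rpow_of_nonneg _ _ (show (0 : ℝ) ≤ 1 / 3 by norm_num)]
  have hsq : ∀ x : ℝ≥0∞, x ^ (2 / 3 : ℝ) = x ^ (1 / 3 : ℝ) * x ^ (1 / 3 : ℝ) := by
    intro x
    rw [← ENNReal.rpow_add_of_nonneg _ _ (by norm_num) (by norm_num)]
    norm_num
  rw [hsq, hsq, hsq]
  ring

/-- The symmetric trilinear form `∫∫ P(z) Q(w) K(-z-w) dz dw`. -/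
noncomputable def tri (P Q K : ℂ → ℂ) : ℂ := ∫ p : ℂ × ℂ, P p.1 * Q p.2 * K (-p.1 - p.2)

/-- Measurable functions in `L^{3/2}(ℝ²)`. -/
structure L32 (P : ℂ → ℂ) : Prop where
  meas : Measurable P
  lp : MemLp P (3 / 2) volume

theorem L32.sub {P Q : ℂ → ℂ} (hP : L32 P) (hQ : L32 Q) : L32 (fun z => P z - Q z) :=
  ⟨hP.1.sub hQ.1, hP.2.sub hQ.2⟩

theorem lintegral_tri_le {P Q K : ℂ → ℂ} (hP : Measurable P) (hQ : Measurable Q)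
    (hK : Measurable K) :
    ∫⁻ p : ℂ × ℂ, ‖P p.1 * Q p.2 * K (-p.1 - p.2)‖ₑ ≤
      eLpNorm P (3 / 2) volume * eLpNorm Q (3 / 2) volume * eLpNorm K (3 / 2) volume := by
  simp_rw [eLpNorm_three_halves, enorm_mul]
  exact lintegral_trilinear_le hP.enorm hQ.enorm hK.enorm

theorem measurable_tri_integrand {P Q K : ℂ → ℂ} (hP : Measurable P) (hQ : Measurable Q)
    (hK : Measurable K) : Measurable fun p : ℂ × ℂ => P p.1 * Q p.2 * K (-p.1 - p.2) :=
  ((hP.comp measurable_fst).mul (hQ.comp measurable_snd)).mul (hK.comp (by fun_prop))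

theorem integrable_tri {P Q K : ℂ → ℂ} (hP : L32 P) (hQ : L32 Q) (hK : L32 K) :
    Integrable fun p : ℂ × ℂ => P p.1 * Q p.2 * K (-p.1 - p.2) :=
  ⟨(measurable_tri_integrand hP.1 hQ.1 hK.1).aestronglyMeasurable,
    (lintegral_tri_le hP.1 hQ.1 hK.1).trans_lt
      (ENNReal.mul_lt_top (ENNReal.mul_lt_top hP.2.2 hQ.2.2) hK.2.2)⟩

theorem norm_tri_le {P Q K : ℂ → ℂ} (hP : L32 P) (hQ : L32 Q) (hK : L32 K) :
    ‖tri P Q K‖ ≤ (eLpNorm P (3 / 2) volume).toReal * (eLpNorm Q (3 / 2) volume).toReal *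
      (eLpNorm K (3 / 2) volume).toReal := by
  rw [← ENNReal.toReal_mul, ← ENNReal.toReal_mul, ← toReal_enorm]
  exact ENNReal.toReal_mono (ENNReal.mul_lt_top (ENNReal.mul_lt_top hP.2.2 hQ.2.2) hK.2.2).ne
    ((enorm_integral_le_lintegral_enorm _).trans (lintegral_tri_le hP.1 hQ.1 hK.1))

theorem tri_comm (P Q K : ℂ → ℂ) : tri P Q K = tri Q P K := by
  rw [tri, tri, Measure.volume_eq_prod, ← integral_prod_swap]
  refine integral_congr_ae (.of_forall fun p => ?_)
  simp only [Prod.fst_swap, Prod.snd_swap]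
  rw [show -p.2 - p.1 = -p.1 - p.2 by ring]
  ring

/-- The three arguments sum to zero, so `w ↦ -z - w` exchanges the last two. Together with
`tri_comm` this gives symmetry under all permutations. -/
theorem tri_swap {P Q K : ℂ → ℂ} (hP : L32 P) (hQ : L32 Q) (hK : L32 K) :
    tri P Q K = tri P K Q := by
  rw [tri, tri, Measure.volume_eq_prod, integral_prod _ (integrable_tri hP hQ hK),
    integral_prod _ (integrable_tri hP hK hQ)]
  refine integral_congr_ae (.of_forall fun z => ?_)
  simp only
  rw [← integral_sub_left_eq_self _ volume (-z)]
  refine integral_congr_ae (.of_forall fun w => ?_)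
  simp only
  rw [show -z - (-z - w) = w by ring]
  ring

theorem tri_sub_right {P Q K₁ K₂ : ℂ → ℂ} (hP : L32 P) (hQ : L32 Q) (hK₁ : L32 K₁)
    (hK₂ : L32 K₂) : tri P Q (fun z => K₁ z - K₂ z) = tri P Q K₁ - tri P Q K₂ := by
  rw [tri, tri, tri, ← integral_sub (integrable_tri hP hQ hK₁) (integrable_tri hP hQ hK₂)]
  refine integral_congr_ae (.of_forall fun p => ?_)
  simp only
  ring

theorem tri_sub_left {P₁ P₂ Q K : ℂ → ℂ} (hP₁ : L32 P₁) (hP₂ : L32 P₂) (hQ : L32 Q)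
    (hK : L32 K) : tri (fun z => P₁ z - P₂ z) Q K = tri P₁ Q K - tri P₂ Q K := by
  rw [tri, tri, tri, ← integral_sub (integrable_tri hP₁ hQ hK) (integrable_tri hP₂ hQ hK)]
  refine integral_congr_ae (.of_forall fun p => ?_)
  simp only
  ring

theorem measurePreserving_circle_mul (a : Circle) :
    MeasurePreserving (fun z : ℂ => (a : ℂ) * z) volume volume :=
  (rotation a).measurePreserving

theorem measurableEmbedding_circle_mul (a : Circle) :
    MeasurableEmbedding (fun z : ℂ => (a : ℂ) * z) :=
  (rotation a).toHomeomorph.measurableEmbedding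

theorem L32.rotate {P : ℂ → ℂ} (hP : L32 P) (a : Circle) : L32 (fun z => P (a * z)) :=
  ⟨hP.1.comp (by fun_prop), hP.2.comp_measurePreserving (measurePreserving_circle_mul a)⟩

theorem tri_rotate (a : Circle) (P Q K : ℂ → ℂ) :
    tri (fun z => P (a * z)) (fun z => Q (a * z)) (fun z => K (a * z)) = tri P Q K := by
  have h : MeasurePreserving (fun p : ℂ × ℂ => ((a : ℂ) * p.1, (a : ℂ) * p.2))
      (volume.prod volume) (volume.prod volume) :=
    (measurePreserving_circle_mul a).prod (measurePreserving_circle_mul a)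
  have he : MeasurableEmbedding (fun p : ℂ × ℂ => ((a : ℂ) * p.1, (a : ℂ) * p.2)) :=
    (measurableEmbedding_circle_mul a).prodMap (measurableEmbedding_circle_mul a)
  rw [tri, tri, Measure.volume_eq_prod,
    ← h.integral_comp he fun p => P p.1 * Q p.2 * K (-p.1 - p.2)]
  refine integral_congr_ae (.of_forall fun p => ?_)
  simp only
  congr 2
  ring

theorem eLpNorm_rotate {P : ℂ → ℂ} (hP : L32 P) (a : Circle) :
    eLpNorm (fun z => P (a * z)) (3 / 2) volume = eLpNorm P (3 / 2) volume :=
  eLpNorm_comp_measurePreserving hP.2.1 (measurePreserving_circle_mul a)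

/-! ### Gain from rotations when pairing with Lipschitz functions. -/

theorem L32_density {f g : Circle → ℂ} (hf : Measurable f) (hg : Measurable g)
    (hf2 : MemLp f 2 σ) (hg2 : MemLp g 2 σ) : L32 (density f g) :=
  ⟨measurable_density hf hg, memLp_density hf hg hf2 hg2⟩

theorem integrable_of_memLp_two {f : Circle → ℂ} (hf : MemLp f 2 σ) : Integrable f σ :=
  hf.integrable (by norm_num)

theorem integrable_prod_mul {f g : Circle → ℂ} (hf : Integrable f σ) (hg : Integrable g σ) :
    Integrable (fun p : Circle × Circle => f p.1 * g p.2) (σ.prod σ) := hf.mul_prod hg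

theorem integrable_density {f g : Circle → ℂ} (hf : Integrable f σ) (hg : Integrable g σ) :
    Integrable (density f g) :=
  (integrable_fold_and_integral (integrable_prod_mul hf hg)).1

theorem norm_circle_add_le (p : Circle × Circle) : ‖(p.1 : ℂ) + p.2‖ ≤ 2 := by
  refine (norm_add_le _ _).trans ?_
  rw [Circle.norm_coe, Circle.norm_coe]; norm_num

theorem measurable_circle_add : Measurable fun p : Circle × Circle => (p.1 : ℂ) + p.2 :=
  (measurable_coe_circle.comp measurable_fst).add (measurable_coe_circle.comp measurable_snd)

theorem integrable_prod_mul_comp_add {f g : Circle → ℂ} (hf : Integrable f σ)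
    (hg : Integrable g σ) {Ψ : ℂ → ℂ} (hΨ : Continuous Ψ) :
    Integrable (fun p : Circle × Circle => f p.1 * g p.2 * Ψ (p.1 + p.2)) (σ.prod σ) := by
  obtain ⟨C, hC⟩ := (isCompact_closedBall (0 : ℂ) 2).exists_bound_of_continuousOn hΨ.continuousOn
  refine (integrable_prod_mul hf hg).mul_bdd (c := C)
    (hΨ.measurable.comp measurable_circle_add).aestronglyMeasurable (.of_forall fun p => hC _ ?_)
  simpa using norm_circle_add_le p

theorem integral_density_mul {f g : Circle → ℂ} (hf : Integrable f σ)
    (hg : Integrable g σ) {Ψ : ℂ → ℂ} (hΨ : Continuous Ψ) :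
    Integrable (fun z => density f g z * Ψ z) ∧
    ∫ z, density f g z * Ψ z = ∫ p : Circle × Circle, f p.1 * g p.2 * Ψ (p.1 + p.2) ∂(σ.prod σ) := by
  have h := integrable_fold_and_integral (integrable_prod_mul_comp_add hf hg hΨ)
  have e : fold (fun p : Circle × Circle => f p.1 * g p.2 * Ψ (p.1 + p.2)) =
      fun z => density f g z * Ψ z := funext fun z => fold_mul_comp_add _ Ψ z
  rw [e] at h
  exact ⟨h.1, h.2.symm⟩

/-- The density is dominated by the one formed from `|f|` and `|g|`, whose integral is exactly the
product. -/
theorem integral_norm_density_le {f g : Circle → ℂ} (hf : Integrable f σ) (hg : Integrable g σ) :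
    ∫ z, ‖density f g z‖ ≤ (∫ x, ‖f x‖ ∂σ) * ∫ x, ‖g x‖ ∂σ := by
  have h := integrable_fold_and_integral (F := fun p => ((‖f p.1‖ * ‖g p.2‖ : ℝ) : ℂ))
    (hf.norm.mul_prod hg.norm).ofReal
  have e : ∀ z, fold (fun p => ((‖f p.1‖ * ‖g p.2‖ : ℝ) : ℂ)) z =
      ((weight z * (‖f (sumFst z)‖ * ‖g (sumSnd z)‖ + ‖f (sumSnd z)‖ * ‖g (sumFst z)‖) : ℝ) : ℂ) := by
    intro z; simp only [fold]; push_cast; ring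
  simp_rw [e] at h
  have h2 := h.2
  rw [integral_complex_ofReal, integral_complex_ofReal, Complex.ofReal_inj,
    integral_prod_mul (fun x => ‖f x‖) (fun x => ‖g x‖)] at h2
  rw [h2]
  have hr := h.1
  rw [funext e] at hr
  refine integral_mono (integrable_density hf hg).norm (by simpa using hr.re) fun z => ?_
  simp only [density, fold, norm_mul, Complex.norm_real, Real.norm_of_nonneg (weight_nonneg z)]
  refine mul_le_mul_of_nonneg_left ((norm_add_le _ _).trans ?_) (weight_nonneg z)
  rw [norm_mul, norm_mul]

/-- Pairing `density (u ∘ R - u) g` with a Lipschitz function gains a factor of the size of the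
rotation `R`. -/
theorem norm_integral_density_rotate_sub_le {u g : Circle → ℂ} (hu : Integrable u σ)
    (hg : Integrable g σ) (a : Circle) {Ψ : ℂ → ℂ} {B : ℝ≥0} (hΨ : LipschitzWith B Ψ) :
    ‖∫ z, density (fun x => u (a * x) - u x) g z * Ψ z‖ ≤
      B * ‖(a : ℂ) - 1‖ * ((∫ x, ‖u x‖ ∂σ) * ∫ x, ‖g x‖ ∂σ) := by
  have hua : Integrable (fun x => u (a * x)) σ :=
    (measurePreserving_mul a).integrable_comp_of_integrable hu
  have hd : Integrable (fun x => u (a * x) - u x) σ := hua.sub hu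
  rw [(integral_density_mul hd hg hΨ.continuous).2]
  have h1 := integrable_prod_mul_comp_add hua hg hΨ.continuous
  have h2 := integrable_prod_mul_comp_add hu hg hΨ.continuous
  have hΨ' : Continuous fun z : ℂ => Ψ z := hΨ.continuous
  -- The rotation is moved from `u` to the first point in the argument of `Ψ`. The difference then
  -- falls on `Ψ`, whose argument changes by exactly `‖a - 1‖`.
  set S : Circle × Circle → ℂ := fun p => u p.1 * g p.2 * Ψ ((a⁻¹ * p.1 : Circle) + p.2) with hS
  have hmp : MeasurePreserving (fun p : Circle × Circle => (a * p.1, p.2)) (σ.prod σ) (σ.prod σ) :=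
    (measurePreserving_mul a).prod (.id σ)
  have hme : MeasurableEmbedding (fun p : Circle × Circle => (a * p.1, p.2)) :=
    (measurableEmbedding_mulLeft a).prodMap .id
  have hSc : (S ∘ fun p : Circle × Circle => (a * p.1, p.2)) =
      fun p : Circle × Circle => u (a * p.1) * g p.2 * Ψ (p.1 + p.2) := by
    ext p; simp [hS]
  have hSi : Integrable S (σ.prod σ) := by
    rw [← hmp.integrable_comp_emb hme, hSc]; exact h1
  have hI : ∫ p, S p ∂(σ.prod σ) =
      ∫ p : Circle × Circle, u (a * p.1) * g p.2 * Ψ (p.1 + p.2) ∂(σ.prod σ) := by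
    rw [← hmp.integral_comp hme]
    exact integral_congr_ae (.of_forall fun p => congrFun hSc p)
  have e : ∫ p : Circle × Circle, (u (a * p.1) - u p.1) * g p.2 * Ψ (p.1 + p.2) ∂(σ.prod σ) =
      ∫ p : Circle × Circle, (S p - u p.1 * g p.2 * Ψ (p.1 + p.2)) ∂(σ.prod σ) := by
    rw [integral_sub hSi h2, hI, ← integral_sub h1 h2]
    exact integral_congr_ae (.of_forall fun p => by simp only; ring)
  rw [e]
  have hn : Integrable (fun p : Circle × Circle => B * ‖(a : ℂ) - 1‖ * (‖u p.1‖ * ‖g p.2‖))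
    (σ.prod σ) := (hu.norm.mul_prod hg.norm).const_mul _
  rw [← integral_prod_mul (fun x => ‖u x‖) (fun x => ‖g x‖), ← integral_const_mul]
  refine norm_integral_le_of_norm_le hn (.of_forall fun p => ?_)
  have e2 : S p - u p.1 * g p.2 * Ψ (p.1 + p.2) =
      (Ψ ((a⁻¹ * p.1 : Circle) + p.2) - Ψ (p.1 + p.2)) * (u p.1 * g p.2) := by
    simp only [hS]; ring
  rw [e2, norm_mul, norm_mul (u p.1)]
  refine mul_le_mul_of_nonneg_right ?_ (by positivity)
  rw [← dist_eq_norm]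
  refine (hΨ.dist_le_mul _ _).trans (mul_le_mul_of_nonneg_left (le_of_eq ?_) B.2)
  rw [dist_eq_norm, Circle.coe_mul, add_sub_add_right_eq_sub]
  calc ‖((a⁻¹ : Circle) : ℂ) * p.1 - p.1‖ = ‖((a⁻¹ : Circle) : ℂ) * (1 - a) * p.1‖ := by
        congr 1
        rw [mul_sub, ← Circle.coe_mul a⁻¹ a, inv_mul_cancel]
        push_cast; ring
    _ = ‖(a : ℂ) - 1‖ := by
        rw [norm_mul, norm_mul, Circle.norm_coe, Circle.norm_coe, norm_sub_rev]; ring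

/-- Integrating `L` against `Q` leaves a Lipschitz function of the remaining variable, with constant
`A ‖Q‖₁`. The bound `M` on `L` serves integrability only and does not enter the estimate. -/
theorem norm_tri_lipschitz_le {u g : Circle → ℂ} (hu : Integrable u σ) (hg : Integrable g σ)
    (a : Circle) {Q L : ℂ → ℂ} (hQ : Integrable Q) {A : ℝ≥0}
    (hL : LipschitzWith A L) {M : ℝ} (hM : ∀ z, ‖L z‖ ≤ M) :
    ‖tri (density (fun x => u (a * x) - u x) g) Q L‖ ≤
      A * (∫ w, ‖Q w‖) * ‖(a : ℂ) - 1‖ * ((∫ x, ‖u x‖ ∂σ) * ∫ x, ‖g x‖ ∂σ) := by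
  have hua : Integrable (fun x => u (a * x)) σ :=
    (measurePreserving_mul a).integrable_comp_of_integrable hu
  have hP := integrable_density (hua.sub hu) hg
  have hi : Integrable (fun p : ℂ × ℂ =>
      density (fun x => u (a * x) - u x) g p.1 * Q p.2 * L (-p.1 - p.2)) (volume.prod volume) :=
    (hP.mul_prod hQ).mul_bdd (c := M)
      (hL.continuous.measurable.comp (by fun_prop)).aestronglyMeasurable (.of_forall fun p => hM _)
  have hLi : ∀ z, Integrable fun w => Q w * L (-z - w) := fun z =>
    hQ.mul_bdd (c := M) (hL.continuous.measurable.comp (by fun_prop)).aestronglyMeasurable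
      (.of_forall fun p => hM _)
  set Ψ : ℂ → ℂ := fun z => ∫ w, Q w * L (-z - w) with hΨ
  have hΨL : LipschitzWith (A * (∫ w, ‖Q w‖).toNNReal) Ψ := by
    refine LipschitzWith.of_dist_le_mul fun x y => ?_
    rw [dist_eq_norm, hΨ]
    simp only
    rw [← integral_sub (hLi x) (hLi y)]
    have : ((A * (∫ w, ‖Q w‖).toNNReal : ℝ≥0) : ℝ) * dist x y = ∫ w, ‖Q w‖ * (A * dist x y) := by
      rw [integral_mul_const, NNReal.coe_mul,
        Real.coe_toNNReal _ (integral_nonneg fun _ => norm_nonneg _)]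
      ring
    rw [this]
    refine norm_integral_le_of_norm_le (hQ.norm.mul_const _) (.of_forall fun w => ?_)
    rw [← mul_sub, norm_mul, ← dist_eq_norm]
    refine mul_le_mul_of_nonneg_left ((hL.dist_le_mul _ _).trans (le_of_eq ?_)) (norm_nonneg _)
    rw [dist_sub_right, dist_neg_neg]
  have h := norm_integral_density_rotate_sub_le hu hg a hΨL
  rw [NNReal.coe_mul, Real.coe_toNNReal _ (integral_nonneg fun _ => norm_nonneg _)] at h
  refine le_trans (le_of_eq ?_) h
  rw [tri, Measure.volume_eq_prod, integral_prod _ hi]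
  congr 1
  refine integral_congr_ae (.of_forall fun z => ?_)
  simp only [hΨ]
  rw [← integral_const_mul]
  exact integral_congr_ae (.of_forall fun w => by simp only; ring)

/-- The norm in `L²(S¹)` as a real number. -/
noncomputable def norm₂ (f : Circle → ℂ) : ℝ := (eLpNorm f 2 σ).toReal

theorem norm₂_nonneg (f : Circle → ℂ) : 0 ≤ norm₂ f := ENNReal.toReal_nonneg

theorem norm₂_rotate {f : Circle → ℂ} (hf : MemLp f 2 σ) (a : Circle) :
    norm₂ (fun x => f (a * x)) = norm₂ f := by
  rw [norm₂, norm₂]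
  congr 1
  exact eLpNorm_comp_measurePreserving hf.1 (measurePreserving_mul a)

noncomputable def holderConst : ℝ := (σ Set.univ ^ (1 / 2 : ℝ)).toReal

theorem integral_norm_le_norm₂ {f : Circle → ℂ} (hf : MemLp f 2 σ) :
    ∫ x, ‖f x‖ ∂σ ≤ holderConst * norm₂ f := by
  have h := eLpNorm_le_eLpNorm_mul_rpow_measure_univ (p := 1) (q := 2) (μ := σ) (by norm_num) hf.1
  rw [integral_norm_eq_lintegral_enorm hf.1, ← eLpNorm_one_eq_lintegral_enorm, norm₂, holderConst,
    ← ENNReal.toReal_mul]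
  refine ENNReal.toReal_mono (ENNReal.mul_ne_top ?_ hf.2.ne) (h.trans (le_of_eq ?_))
  · exact ENNReal.rpow_ne_top_of_nonneg (by norm_num) (measure_ne_top _ _)
  · rw [mul_comm]; norm_num

theorem eLpNorm_density_toReal_le {f g : Circle → ℂ} (hf : Measurable f) (hg : Measurable g)
    (hf2 : MemLp f 2 σ) (hg2 : MemLp g 2 σ) :
    (eLpNorm (density f g) (3 / 2) volume).toReal ≤
      densityConst.toReal * (norm₂ f * norm₂ g) := by
  rw [norm₂, norm₂, ← ENNReal.toReal_mul, ← ENNReal.toReal_mul]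
  exact ENNReal.toReal_mono (ENNReal.mul_ne_top densityConst_ne_top
    (ENNReal.mul_ne_top hf2.2.ne hg2.2.ne)) (eLpNorm_density_le hf hg hf2 hg2)

theorem memLp_rotate_sub {u : Circle → ℂ} (hu : MemLp u 2 σ) (a : Circle) :
    MemLp (fun x => u (a * x) - u x) 2 σ :=
  (hu.comp_measurePreserving (measurePreserving_mul a)).sub hu

theorem measurable_rotate {u : Circle → ℂ} (hu : Measurable u) (a : Circle) :
    Measurable fun x => u (a * x) := hu.comp (measurable_const_mul a)

/-- Lipschitz functions being dense in `L^{3/2}`, the form `tri` with one entry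
`density (u ∘ R - u) g` is small up to a multiple of the size of the rotation `R`. -/
theorem exists_norm_tri_rotate_sub_le {K : ℂ → ℂ} (hK : L32 K) {ε : ℝ} (hε : 0 < ε) :
    ∃ A : ℝ, 0 ≤ A ∧ ∀ (c a : Circle) (u g q g' : Circle → ℂ), Measurable u → Measurable g →
      Measurable q → Measurable g' → MemLp u 2 σ → MemLp g 2 σ → MemLp q 2 σ → MemLp g' 2 σ →
      ‖tri (density (fun x => u (a * x) - u x) g) (density q g') (fun z => K (c * z))‖ ≤
        (ε * norm₂ (fun x => u (a * x) - u x) + A * ‖(a : ℂ) - 1‖ * norm₂ u) *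
          (norm₂ g * norm₂ q * norm₂ g') := by
  set C := densityConst.toReal with hC
  have hC0 : 0 ≤ C := ENNReal.toReal_nonneg
  -- The two densities contribute `C * C`; the `1` keeps the denominator positive.
  set η : ℝ := ε / (C * C + 1) with hη
  have hη0 : 0 < η := by positivity
  obtain ⟨L, hLc, hLd, hLε⟩ := hK.lp.exist_eLpNorm_sub_le three_halves_ne_top
    (by rw [ENNReal.le_div_iff_mul_le (by simp) (by simp)]; norm_num) hη0
  obtain ⟨A, hA⟩ := (hLd.of_le (by norm_num)).lipschitzWith_of_hasCompactSupport hLc one_ne_zero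
  obtain ⟨M, hM⟩ := hLd.continuous.bounded_above_of_compact_support hLc
  have hL32 : L32 L := ⟨hLd.continuous.measurable, hLd.continuous.memLp_of_hasCompactSupport hLc⟩
  have hE : L32 (fun z => K z - L z) := hK.sub hL32
  have hEn : (eLpNorm (fun z => K z - L z) (3 / 2) volume).toReal ≤ η :=
    ENNReal.toReal_le_of_le_ofReal hη0.le hLε
  set h := holderConst with hh
  have h0 : 0 ≤ h := ENNReal.toReal_nonneg
  -- One factor `h` for each passage from `L²` to `L¹`, for `u`, `g`, `q`, `g'`. The constant is
  -- independent of `c` and `a`, since composing with a rotation changes neither the Lipschitz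
  -- constant of `L` nor the `L^{3/2}` norm of `K - L`.
  refine ⟨A * (h * h * (h * h)), by positivity, ?_⟩
  intro c a u g q g' hu hg hq hg' hu2 hg2 hq2 hg2'
  have hdm : Measurable fun x => u (a * x) - u x := (measurable_rotate hu a).sub hu
  have hd2 := memLp_rotate_sub hu2 a
  have hP := L32_density hdm hg hd2 hg2
  have hQ := L32_density hq hg' hq2 hg2'
  have hLr := hL32.rotate c
  have hEr := hE.rotate c
  have hsplit : tri (density (fun x => u (a * x) - u x) g) (density q g') (fun z => K (c * z)) =
      tri (density (fun x => u (a * x) - u x) g) (density q g') (fun z => K (c * z) - L (c * z)) +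
      tri (density (fun x => u (a * x) - u x) g) (density q g') (fun z => L (c * z)) := by
    rw [tri_sub_right hP hQ (hK.rotate c) hLr]; ring
  rw [hsplit]
  refine (norm_add_le _ _).trans ?_
  rw [add_mul]
  have n1 := norm₂_nonneg (fun x => u (a * x) - u x)
  have n2 := norm₂_nonneg u
  have n3 := norm₂_nonneg g
  have n4 := norm₂_nonneg q
  have n5 := norm₂_nonneg g'
  refine add_le_add ?_ ?_
  · refine (norm_tri_le hP hQ hEr).trans ?_
    have b1 := eLpNorm_density_toReal_le hdm hg hd2 hg2
    have b2 := eLpNorm_density_toReal_le hq hg' hq2 hg2'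
    have b3 : (eLpNorm (fun z => K (c * z) - L (c * z)) (3 / 2) volume).toReal ≤ η := by
      rw [eLpNorm_rotate hE c]; exact hEn
    calc _ ≤ (C * (norm₂ (fun x => u (a * x) - u x) * norm₂ g)) * (C * (norm₂ q * norm₂ g')) * η := by
          gcongr
      _ = (C * C * η) * (norm₂ (fun x => u (a * x) - u x) * (norm₂ g * norm₂ q * norm₂ g')) := by ring
      _ ≤ ε * (norm₂ (fun x => u (a * x) - u x) * (norm₂ g * norm₂ q * norm₂ g')) := by
          gcongr
          rw [hη, ← mul_div_assoc, div_le_iff₀ (by positivity)]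
          nlinarith
      _ = _ := by ring
  · have hLl : LipschitzWith A (fun z => L (c * z)) := by
      refine LipschitzWith.of_dist_le_mul fun x y => (hA.dist_le_mul _ _).trans (le_of_eq ?_)
      rw [dist_eq_norm, dist_eq_norm, ← mul_sub, norm_mul, Circle.norm_coe, one_mul]
    have b := norm_tri_lipschitz_le (integrable_of_memLp_two hu2) (integrable_of_memLp_two hg2) a
      (integrable_density (integrable_of_memLp_two hq2) (integrable_of_memLp_two hg2')) hLl
      (fun z => hM (c * z))
    refine b.trans ?_
    have b1 := integral_norm_le_norm₂ hu2
    have b2 := integral_norm_le_norm₂ hg2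
    have b3 := integral_norm_le_norm₂ hq2
    have b4 := integral_norm_le_norm₂ hg2'
    have b5 : ∫ w, ‖density q g' w‖ ≤ (h * norm₂ q) * (h * norm₂ g') :=
      (integral_norm_density_le (integrable_of_memLp_two hq2) (integrable_of_memLp_two hg2')).trans
        (by gcongr)
    calc _ ≤ A * ((h * norm₂ q) * (h * norm₂ g')) * ‖(a : ℂ) - 1‖ *
          ((h * norm₂ u) * (h * norm₂ g)) := by
          gcongr
      _ = _ := by ring

/-! ### Identification of the Radon-Nikodym density with the explicit one. -/

theorem conv₂_eq_withDensity {f g : Circle → ℂ} (hf : Integrable f σ) (hg : Integrable g σ) :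
    conv₂ f g = volume.withDensityᵥ (density f g) := by
  have hF := integrable_prod_mul hf hg
  ext1 s hs
  have hs' := measurable_circle_add hs
  rw [conv₂, VectorMeasure.map_apply _ measurable_circle_add hs,
    withDensityᵥ_apply hF hs', withDensityᵥ_apply (integrable_density hf hg) hs,
    ← integral_indicator hs', ← integral_indicator hs,
    (integrable_fold_and_integral (hF.indicator hs')).2]
  refine integral_congr_ae (.of_forall fun z => ?_)
  have h := fold_mul_comp_add (fun p : Circle × Circle => f p.1 * g p.2) (s.indicator 1) z
  have e : ((fun p : Circle × Circle => (p.1 : ℂ) + p.2) ⁻¹' s).indicator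
      (fun p : Circle × Circle => f p.1 * g p.2) =
      fun p : Circle × Circle => f p.1 * g p.2 * s.indicator (1 : ℂ → ℂ) (p.1 + p.2) := by
    ext p
    by_cases hp : (p.1 : ℂ) + p.2 ∈ s <;> simp [Set.indicator, hp]
  rw [e, h]
  by_cases hz : z ∈ s <;> simp [Set.indicator, hz, density]

/-- Uniqueness of the Lebesgue decomposition with singular part zero, applied to real and imaginary
parts. -/
theorem ComplexMeasure_rnDeriv_withDensity {D : ℂ → ℂ} (hD : Integrable D) :
    ComplexMeasure.rnDeriv (volume.withDensityᵥ D) (volume : Measure ℂ) =ᵐ[volume] D := by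
  have hre : ComplexMeasure.re (volume.withDensityᵥ D) =
      (volume : Measure ℂ).withDensityᵥ fun z => (D z).re := by
    ext1 s hs
    have hi : Integrable fun z => (D z).re := hD.re
    rw [withDensityᵥ_apply hi hs]
    change (volume.withDensityᵥ D s).re = _
    rw [withDensityᵥ_apply hD hs]
    exact (integral_re hD.integrableOn).symm
  have him : ComplexMeasure.im (volume.withDensityᵥ D) =
      (volume : Measure ℂ).withDensityᵥ fun z => (D z).im := by
    ext1 s hs
    have hi : Integrable fun z => (D z).im := hD.im
    rw [withDensityᵥ_apply hi hs]
    change (volume.withDensityᵥ D s).im = _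
    rw [withDensityᵥ_apply hD hs]
    exact (integral_im hD.integrableOn).symm
  have key : ∀ {g : ℂ → ℝ}, Integrable g →
      g =ᵐ[volume] SignedMeasure.rnDeriv (volume.withDensityᵥ g) volume := fun hg =>
    SignedMeasure.eq_rnDeriv 0 _ hg (VectorMeasure.MutuallySingular.zero_left) (zero_add _).symm
  filter_upwards [key hD.re, key hD.im] with z h1 h2
  rw [ComplexMeasure.rnDeriv, hre, him]
  exact Complex.ext h1.symm h2.symm

theorem convDensity₂_ae_eq {f g : Circle → ℂ} (hf : Integrable f σ) (hg : Integrable g σ) :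
    convDensity₂ f g =ᵐ[volume] density f g := by
  rw [convDensity₂, conv₂_eq_withDensity hf hg]
  exact ComplexMeasure_rnDeriv_withDensity (integrable_density hf hg)

theorem quasiMeasurePreserving_circle_add :
    Measure.QuasiMeasurePreserving (fun p : Circle × Circle => (p.1 : ℂ) + p.2) (σ.prod σ) volume := by
  refine ⟨measurable_circle_add, Measure.AbsolutelyContinuous.mk fun s hs h0 => ?_⟩
  rw [Measure.map_apply measurable_circle_add hs, ← lintegral_indicator_one
    (measurable_circle_add hs), lintegral_prod_σ (measurable_one.indicator (measurable_circle_add hs))]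
  rw [lintegral_congr_ae (g := fun _ => 0), lintegral_zero]
  filter_upwards [measure_eq_zero_iff_ae_notMem.1 h0] with z hz
  by_cases hw : weight z = 0
  · simp [hw]
  · have h := sumFst_add_sumSnd (norm_lt_two_of_weight_ne_zero hw).le
    have h' : (sumSnd z : ℂ) + sumFst z = z := by rw [add_comm, h]
    simp [Set.indicator, h, h', hz]

theorem measurable_circle_add₃ :
    Measurable fun p : Circle × Circle × Circle => (p.1 : ℂ) + p.2.1 + p.2.2 :=
  ((measurable_coe_circle.comp measurable_fst).add
    (measurable_coe_circle.comp (measurable_fst.comp measurable_snd))).add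
    (measurable_coe_circle.comp (measurable_snd.comp measurable_snd))

/-- With the first point fixed, the sum of the other two already has an absolutely continuous law.
Hence, at every `x`, `convDensity₂` in `conv₅` may be replaced by `density`. -/
theorem ae_comp_sub_circle_add₃ {D D' : ℂ → ℂ} (h : D =ᵐ[volume] D') (x : ℂ) :
    ∀ᵐ p : Circle × Circle × Circle ∂(σ.prod (σ.prod σ)),
      D (x - ((p.1 : ℂ) + p.2.1 + p.2.2)) = D' (x - ((p.1 : ℂ) + p.2.1 + p.2.2)) := by
  obtain ⟨N, hN, hNm, hN0⟩ := exists_measurable_superset_of_null h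
  have hm : Measurable fun p : Circle × Circle × Circle => x - ((p.1 : ℂ) + p.2.1 + p.2.2) :=
    measurable_const.sub measurable_circle_add₃
  have h0 : ∀ᵐ p : Circle × Circle × Circle ∂(σ.prod (σ.prod σ)),
      x - ((p.1 : ℂ) + p.2.1 + p.2.2) ∉ N := by
    refine (measure_eq_zero_iff_ae_notMem (s := (fun p : Circle × Circle × Circle =>
      x - ((p.1 : ℂ) + p.2.1 + p.2.2)) ⁻¹' N)).1 ?_
    rw [Measure.measure_prod_null (hm hNm)]
    refine .of_forall fun a => ?_
    have h1 : Measure.QuasiMeasurePreserving (fun z : ℂ => (x - a) - z) volume volume :=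
      quasiMeasurePreserving_sub_left volume (x - (a : ℂ))
    have h2 := (h1.comp quasiMeasurePreserving_circle_add).preimage_null hN0
    refine measure_mono_null (fun r hr => ?_) h2
    simp only [Set.mem_preimage, Function.comp] at hr ⊢
    convert hr using 1
    ring
  filter_upwards [h0] with p hp
  by_contra hne
  exact hp (hN hne)

/-! ### The fivefold convolution, tested against a function, as a trilinear form. -/

/-- Absolute values, as a complex-valued function. -/
noncomputable def absFun (f : Circle → ℂ) : Circle → ℂ := fun x => (‖f x‖ : ℂ)

theorem measurable_absFun {f : Circle → ℂ} (hf : Measurable f) : Measurable (absFun f) :=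
  Complex.measurable_ofReal.comp hf.norm

theorem memLp_absFun {f : Circle → ℂ} (hf : MemLp f 2 σ) : MemLp (absFun f) 2 σ :=
  hf.norm.ofReal

theorem enorm_density_absFun (f g : Circle → ℂ) (z : ℂ) :
    ‖density (absFun f) (absFun g) z‖ₑ = ENNReal.ofReal (weight z) *
      (‖f (sumFst z)‖ₑ * ‖g (sumSnd z)‖ₑ + ‖f (sumSnd z)‖ₑ * ‖g (sumFst z)‖ₑ) := by
  have e : density (absFun f) (absFun g) z = ((weight z * (‖f (sumFst z)‖ * ‖g (sumSnd z)‖ +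
      ‖f (sumSnd z)‖ * ‖g (sumFst z)‖) : ℝ) : ℂ) := by
    simp only [density, fold, absFun]; push_cast; ring
  have hw := weight_nonneg z
  rw [e, ← ofReal_norm, Complex.norm_real, Real.norm_of_nonneg (by positivity),
    ENNReal.ofReal_mul hw, ENNReal.ofReal_add (by positivity) (by positivity),
    ENNReal.ofReal_mul (by positivity), ENNReal.ofReal_mul (by positivity)]
  simp only [ofReal_norm]

theorem lintegral_prod_mul_comp_add {f g : Circle → ℂ} (hf : Measurable f) (hg : Measurable g)
    {Θ : ℂ → ℝ≥0∞} (hΘ : Measurable Θ) :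
    ∫⁻ p : Circle × Circle, ‖f p.1‖ₑ * ‖g p.2‖ₑ * Θ (p.1 + p.2) ∂(σ.prod σ) =
      ∫⁻ z, ‖density (absFun f) (absFun g) z‖ₑ * Θ z := by
  rw [lintegral_prod_σ]
  · refine lintegral_congr fun z => ?_
    rw [enorm_density_absFun]
    by_cases hz : weight z = 0
    · simp [hz]
    · have h := sumFst_add_sumSnd (norm_lt_two_of_weight_ne_zero hz).le
      have h' : (sumSnd z : ℂ) + sumFst z = z := by rw [add_comm, h]
      simp only [h, h']
      ring
  · exact ((hf.comp measurable_fst).enorm.mul (hg.comp measurable_snd).enorm).mul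
      (hΘ.comp measurable_circle_add)

theorem measurable_convolution_integrand {g₁ g₂ g₃ g₄ : Circle → ℂ} {K : ℂ → ℂ}
    (h₁ : Measurable g₁) (h₂ : Measurable g₂) (h₃ : Measurable g₃) (h₄ : Measurable g₄)
    (hK : Measurable K) :
    Measurable fun p : (Circle × Circle) × Circle × Circle =>
      g₁ p.1.1 * g₂ p.1.2 * (g₃ p.2.1 * g₄ p.2.2 *
        K (-((p.2.1 : ℂ) + p.2.2) - (p.1.1 + p.1.2))) := by
  have m1 : Measurable fun p : (Circle × Circle) × Circle × Circle => p.1.1 :=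
    measurable_fst.comp measurable_fst
  have m2 : Measurable fun p : (Circle × Circle) × Circle × Circle => p.1.2 :=
    measurable_snd.comp measurable_fst
  have m3 : Measurable fun p : (Circle × Circle) × Circle × Circle => p.2.1 :=
    measurable_fst.comp measurable_snd
  have m4 : Measurable fun p : (Circle × Circle) × Circle × Circle => p.2.2 :=
    measurable_snd.comp measurable_snd
  have mc := measurable_coe_circle
  exact ((h₁.comp m1).mul (h₂.comp m2)).mul (((h₃.comp m3).mul (h₄.comp m4)).mul
    (hK.comp (((mc.comp m3).add (mc.comp m4)).neg.sub ((mc.comp m1).add (mc.comp m2)))))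

/-- By Tonelli this is the trilinear integral of absolute values with a density formed by `absFun`,
finite by Young's inequality. It supplies the absolute convergence behind the uses of Fubini below.
-/
theorem lintegral_comp_add_lt_top {g₁ g₂ : Circle → ℂ} {P K : ℂ → ℂ}
    (h₁ : Measurable g₁) (h₂ : Measurable g₂) (h₁' : MemLp g₁ 2 σ) (h₂' : MemLp g₂ 2 σ)
    (hP : L32 P) (hK : L32 K) :
    ∫⁻ p : Circle × Circle, ‖g₁ p.1‖ₑ * ‖g₂ p.2‖ₑ *
        (∫⁻ z, ‖P z‖ₑ * ‖K (-z - (p.1 + p.2))‖ₑ) ∂(σ.prod σ) < ∞ := by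
  have hQ := L32_density (measurable_absFun h₁) (measurable_absFun h₂)
    (memLp_absFun h₁') (memLp_absFun h₂')
  set Q := density (absFun g₁) (absFun g₂)
  have hmt := (measurable_tri_integrand hP.1 hQ.1 hK.1).enorm
  have hΘ : Measurable fun w => ∫⁻ z, ‖P z‖ₑ * ‖K (-z - w)‖ₑ := by
    refine Measurable.lintegral_prod_right' (f := fun p : ℂ × ℂ => ‖P p.2‖ₑ * ‖K (-p.2 - p.1)‖ₑ) ?_
    exact (hP.1.comp measurable_snd).enorm.mul (hK.1.comp (by fun_prop)).enorm
  calc _ = ∫⁻ w, ‖Q w‖ₑ * ∫⁻ z, ‖P z‖ₑ * ‖K (-z - w)‖ₑ :=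
        lintegral_prod_mul_comp_add h₁ h₂ hΘ
    _ = ∫⁻ p : ℂ × ℂ, ‖P p.1 * Q p.2 * K (-p.1 - p.2)‖ₑ := by
        rw [Measure.volume_eq_prod, lintegral_prod_symm _ hmt.aemeasurable]
        refine lintegral_congr fun w => ?_
        rw [← lintegral_const_mul' _ _ enorm_ne_top]
        refine lintegral_congr fun z => ?_
        simp only [enorm_mul]
        ring
    _ < ∞ := (integrable_tri hP hQ hK).2

theorem integral_comp_add_eq_tri {g₁ g₂ : Circle → ℂ} {P K : ℂ → ℂ}
    (h₁ : Measurable g₁) (h₂ : Measurable g₂) (h₁' : MemLp g₁ 2 σ) (h₂' : MemLp g₂ 2 σ)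
    (hP : L32 P) (hK : L32 K) :
    ∫ p : Circle × Circle, g₁ p.1 * g₂ p.2 *
        (∫ z, P z * K (-z - (p.1 + p.2))) ∂(σ.prod σ) = tri P (density g₁ g₂) K := by
  have hQ := L32_density h₁ h₂ h₁' h₂'
  set Ψ : ℂ → ℂ := fun w => ∫ z, P z * K (-z - w) with hΨ
  have hΨm : Measurable Ψ := by
    refine StronglyMeasurable.measurable (StronglyMeasurable.integral_prod_right'
      (f := fun p : ℂ × ℂ => P p.2 * K (-p.2 - p.1)) ?_)
    exact ((hP.1.comp measurable_snd).mul (hK.1.comp (by fun_prop))).stronglyMeasurable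
  have hi2 : Integrable (fun p : Circle × Circle => g₁ p.1 * g₂ p.2 * Ψ (p.1 + p.2)) (σ.prod σ) := by
    refine ⟨(((h₁.comp measurable_fst).mul (h₂.comp measurable_snd)).mul
      (hΨm.comp measurable_circle_add)).aestronglyMeasurable,
      lt_of_le_of_lt (lintegral_mono fun p => ?_)
        (lintegral_comp_add_lt_top h₁ h₂ h₁' h₂' hP hK)⟩
    simp only [enorm_mul]
    gcongr
    refine (enorm_integral_le_lintegral_enorm _).trans (le_of_eq ?_)
    simp only [enorm_mul]
  change ∫ p : Circle × Circle, g₁ p.1 * g₂ p.2 * Ψ (p.1 + p.2) ∂(σ.prod σ) = _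
  rw [(integrable_fold_and_integral hi2).2, tri, Measure.volume_eq_prod,
    integral_prod_symm _ (integrable_tri hP hQ hK)]
  refine integral_congr_ae (.of_forall fun w => ?_)
  simp only
  rw [fold_mul_comp_add (fun p => g₁ p.1 * g₂ p.2) Ψ w, hΨ]
  simp only
  rw [← integral_const_mul]
  refine integral_congr_ae (.of_forall fun z => ?_)
  simp only [density]
  ring

theorem integrable_convolution_integrand {g₁ g₂ g₃ g₄ : Circle → ℂ} {K : ℂ → ℂ}
    (h₁ : Measurable g₁) (h₂ : Measurable g₂) (h₃ : Measurable g₃) (h₄ : Measurable g₄)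
    (h₁' : MemLp g₁ 2 σ) (h₂' : MemLp g₂ 2 σ) (h₃' : MemLp g₃ 2 σ) (h₄' : MemLp g₄ 2 σ)
    (hK : L32 K) :
    Integrable (fun p : (Circle × Circle) × Circle × Circle =>
      g₁ p.1.1 * g₂ p.1.2 * (g₃ p.2.1 * g₄ p.2.2 *
        K (-((p.2.1 : ℂ) + p.2.2) - (p.1.1 + p.1.2)))) ((σ.prod σ).prod (σ.prod σ)) := by
  have hm := measurable_convolution_integrand h₁ h₂ h₃ h₄ hK.1
  refine ⟨hm.aestronglyMeasurable, ?_⟩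
  rw [HasFiniteIntegral, lintegral_prod _ hm.enorm.aemeasurable]
  have hP := L32_density (measurable_absFun h₃) (measurable_absFun h₄)
    (memLp_absFun h₃') (memLp_absFun h₄')
  set P := density (absFun g₃) (absFun g₄)
  calc _ = ∫⁻ p : Circle × Circle, ‖g₁ p.1‖ₑ * ‖g₂ p.2‖ₑ *
        (∫⁻ z, ‖P z‖ₑ * ‖K (-z - (p.1 + p.2))‖ₑ) ∂(σ.prod σ) := by
        refine lintegral_congr fun p => ?_
        rw [← lintegral_prod_mul_comp_add h₃ h₄ (Θ := fun z => ‖K (-z - (p.1 + p.2))‖ₑ)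
          (hK.1.comp (by fun_prop)).enorm, ← lintegral_const_mul' _ _
          (ENNReal.mul_ne_top enorm_ne_top enorm_ne_top)]
        refine lintegral_congr fun r => ?_
        simp only [enorm_mul]
    _ < ∞ := lintegral_comp_add_lt_top h₁ h₂ h₁' h₂' hP hK

theorem integral_convolution_integrand {g₁ g₂ g₃ g₄ : Circle → ℂ} {K : ℂ → ℂ}
    (h₁ : Measurable g₁) (h₂ : Measurable g₂) (h₃ : Measurable g₃) (h₄ : Measurable g₄)
    (h₁' : MemLp g₁ 2 σ) (h₂' : MemLp g₂ 2 σ) (h₃' : MemLp g₃ 2 σ) (h₄' : MemLp g₄ 2 σ)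
    (hK : L32 K) :
    ∫ p : (Circle × Circle) × Circle × Circle,
      g₁ p.1.1 * g₂ p.1.2 * (g₃ p.2.1 * g₄ p.2.2 *
        K (-((p.2.1 : ℂ) + p.2.2) - (p.1.1 + p.1.2))) ∂((σ.prod σ).prod (σ.prod σ)) =
      tri (density g₃ g₄) (density g₁ g₂) K := by
  have hi := integrable_convolution_integrand h₁ h₂ h₃ h₄ h₁' h₂' h₃' h₄' hK
  have hP := L32_density h₃ h₄ h₃' h₄'
  have hQ := L32_density h₁ h₂ h₁' h₂'
  set Ψ : ℂ → ℂ := fun w => ∫ z, density g₃ g₄ z * K (-z - w) with hΨ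
  have hin : ∀ᵐ p : Circle × Circle ∂(σ.prod σ),
      ∫ r : Circle × Circle, g₁ p.1 * g₂ p.2 * (g₃ r.1 * g₄ r.2 *
        K (-((r.1 : ℂ) + r.2) - (p.1 + p.2))) ∂(σ.prod σ) = g₁ p.1 * g₂ p.2 * Ψ (p.1 + p.2) := by
    filter_upwards [hi.prod_right_ae] with p hp
    rw [integral_const_mul]
    -- Where this factor vanishes, integrability of the remaining one on the fibre is not available,
    -- but both sides are zero.
    by_cases hc : g₁ p.1 * g₂ p.2 = 0
    · rw [hc, zero_mul, zero_mul]
    congr 1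
    have hp' := (integrable_const_mul_iff (Ne.isUnit hc) _).1 hp
    rw [(integrable_fold_and_integral hp').2]
    refine integral_congr_ae (.of_forall fun z => ?_)
    exact fold_mul_comp_add (fun p => g₃ p.1 * g₄ p.2) (fun z => K (-z - (p.1 + p.2))) z
  rw [integral_prod _ hi, integral_congr_ae hin]
  exact integral_comp_add_eq_tri h₁ h₂ h₁' h₂' hP hK

/-- `f` reflected at the origin. -/
noncomputable def reflect (f : Circle → ℂ) : Circle → ℂ := fun x => f (-x)

theorem measurable_neg_circle : Measurable fun x : Circle => -x := measurePreserving_neg.measurable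

theorem measurable_reflect {f : Circle → ℂ} (hf : Measurable f) : Measurable (reflect f) :=
  hf.comp measurable_neg_circle

theorem memLp_reflect {f : Circle → ℂ} (hf : MemLp f 2 σ) : MemLp (reflect f) 2 σ :=
  hf.comp_measurePreserving measurePreserving_neg

theorem norm₂_reflect {f : Circle → ℂ} (hf : MemLp f 2 σ) : norm₂ (reflect f) = norm₂ f := by
  rw [norm₂, norm₂]
  congr 1
  exact eLpNorm_comp_measurePreserving hf.1 measurePreserving_neg

/-- Reflecting the outer variable turns `x - (y₁ + y₂ + y₃)` into `-(y₂ + y₃) - (-x + y₁)`, the form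
of the argument in `tri`. Hence `q` enters reflected and is paired with `f₁`. -/
theorem integral_mul_convolution {q f₁ f₂ f₃ : Circle → ℂ} {K : ℂ → ℂ}
    (hq : Measurable q) (h₁ : Measurable f₁) (h₂ : Measurable f₂) (h₃ : Measurable f₃)
    (hq' : MemLp q 2 σ) (h₁' : MemLp f₁ 2 σ) (h₂' : MemLp f₂ 2 σ) (h₃' : MemLp f₃ 2 σ)
    (hK : L32 K) :
    ∫ x, q x * ∫ p : Circle × Circle × Circle, f₁ p.1 * f₂ p.2.1 * f₃ p.2.2 *
      K (x - ((p.1 : ℂ) + p.2.1 + p.2.2)) ∂(σ.prod (σ.prod σ)) ∂σ =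
      tri (density f₂ f₃) (density (reflect q) f₁) K := by
  rw [← integral_convolution_integrand (measurable_reflect hq) h₁ h₂ h₃ (memLp_reflect hq')
    h₁' h₂' h₃' hK]
  have hi := integrable_convolution_integrand (measurable_reflect hq) h₁ h₂ h₃ (memLp_reflect hq')
    h₁' h₂' h₃' hK
  set J : (Circle × Circle) × Circle × Circle → ℂ := fun p =>
    reflect q p.1.1 * f₁ p.1.2 * (f₂ p.2.1 * f₃ p.2.2 *
        K (-((p.2.1 : ℂ) + p.2.2) - (p.1.1 + p.1.2))) with hJ
  set T : Circle × Circle × Circle × Circle → (Circle × Circle) × Circle × Circle :=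
    fun p => ((-p.1, p.2.1), p.2.2) with hT
  have hneg : MeasurableEmbedding fun x : Circle => -x :=
    (Homeomorph.neg Circle).measurableEmbedding
  have hTmp : MeasurePreserving T (σ.prod (σ.prod (σ.prod σ))) ((σ.prod σ).prod (σ.prod σ)) :=
    (((measurePreserving_neg.prod (.id σ)).prod (.id (σ.prod σ))).comp
      (measurePreserving_prodAssoc σ σ (σ.prod σ)).symm)
  have hTe : MeasurableEmbedding T :=
    ((hneg.prodMap .id).prodMap .id).comp MeasurableEquiv.prodAssoc.symm.measurableEmbedding
  have hi2 : Integrable (J ∘ T) (σ.prod (σ.prod (σ.prod σ))) :=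
    (hTmp.integrable_comp_emb hTe).2 hi
  rw [← hTmp.integral_comp hTe]
  change _ = ∫ x, (J ∘ T) x ∂_
  rw [integral_prod _ hi2]
  refine integral_congr_ae (.of_forall fun x => ?_)
  simp only
  rw [← integral_const_mul]
  refine integral_congr_ae (.of_forall fun p => ?_)
  simp only [hJ, hT, Function.comp, reflect, neg_neg]
  have e : -((p.2.1 : ℂ) + p.2.2) - (((-x : Circle) : ℂ) + p.1) =
      x - ((p.1 : ℂ) + p.2.1 + p.2.2) := by
    rw [Circle.coe_neg]; ring
  rw [e]
  ring

/-! ### The weak equation and the Lipschitz bound for a nonzero multiplier. -/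

theorem measurable_tilde {f : Circle → ℂ} (hf : Measurable f) : Measurable (tilde f) :=
  Complex.continuous_conj.measurable.comp (hf.comp measurable_neg_circle)

theorem memLp_tilde {f : Circle → ℂ} (hf : MemLp f 2 σ) : MemLp (tilde f) 2 σ :=
  (memLp_reflect hf).star

theorem norm₂_tilde {f : Circle → ℂ} (hf : MemLp f 2 σ) : norm₂ (tilde f) = norm₂ f := by
  rw [← norm₂_reflect hf, norm₂, norm₂]
  congr 1
  exact eLpNorm_congr_norm_ae (.of_forall fun x => by simp [tilde, reflect])

/-- The weak form of the Euler-Lagrange equation. -/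
theorem EulerLagrange.integral_eq {f q : Circle → ℂ} {c : ℂ} (h : EulerLagrange c f)
    (hf : Measurable f) (hf' : MemLp f 2 σ) (hq : Measurable q) (hq' : MemLp q 2 σ) :
    c * ∫ x, q x * f x ∂σ =
      tri (density f f) (density (reflect q) f) (density (tilde f) (tilde f)) := by
  have hK := L32_density (measurable_tilde hf) (measurable_tilde hf) (memLp_tilde hf')
    (memLp_tilde hf')
  rw [← integral_mul_convolution hq hf hf hf hq' hf' hf' hf' hK, ← integral_const_mul]
  refine integral_congr_ae ?_
  filter_upwards [h] with x hx
  rw [mul_left_comm, ← hx, conv₅]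
  congr 1
  refine integral_congr_ae ?_
  have hti := integrable_of_memLp_two (memLp_tilde hf')
  filter_upwards [ae_comp_sub_circle_add₃ (convDensity₂_ae_eq hti hti) x] with p hp
  rw [hp]

/-- The weak equation is tested with `q` rotated backwards, then the whole form is rotated: by
equivariance of `density` the rotation disappears from `q` and lands on the copies of `f` and `tilde
f`. -/
theorem EulerLagrange.integral_rotate_eq {f q : Circle → ℂ} {c : ℂ} (h : EulerLagrange c f)
    (hf : Measurable f) (hf' : MemLp f 2 σ) (hq : Measurable q) (hq' : MemLp q 2 σ) (a : Circle) :
    c * ∫ x, q x * f (a * x) ∂σ =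
      tri (fun z => density f f (a * z)) (density (reflect q) fun x => f (a * x))
        (fun z => density (tilde f) (tilde f) (a * z)) := by
  have h1 := h.integral_eq hf hf' (measurable_rotate hq a⁻¹)
    (hq'.comp_measurePreserving (measurePreserving_mul a⁻¹))
  have e1 : ∫ x, q x * f (a * x) ∂σ = ∫ x, q (a⁻¹ * x) * f x ∂σ := by
    rw [← integral_mul_left_eq_self (fun x => q (a⁻¹ * x) * f x) a]
    simp
  rw [e1]
  refine h1.trans ?_
  rw [← tri_rotate a]
  congr 1
  ext z
  rw [← density_mul]
  congr 1
  ext x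
  simp [reflect]

/-- The telescoped difference of the Euler-Lagrange equation for `f` and its rotate. -/
theorem tri_sub_tri {P P' Q Q' K K' : ℂ → ℂ} (hP : L32 P) (hP' : L32 P') (hQ : L32 Q)
    (hQ' : L32 Q') (hK : L32 K) (hK' : L32 K') :
    tri P' Q' K' - tri P Q K = tri (fun z => P' z - P z) Q' K' +
      tri (fun z => Q' z - Q z) P K' + tri (fun z => K' z - K z) Q P := by
  rw [tri_sub_left hP' hP hQ' hK', tri_sub_left hQ' hQ hP hK', tri_sub_left hK' hK hQ hP,
    tri_comm Q' P, tri_comm Q P, tri_comm K' Q, tri_comm K Q, tri_swap hQ hK' hP, tri_swap hQ hK hP,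
    tri_comm Q P, tri_comm Q P]
  ring

theorem tri_add_left {P₁ P₂ Q K : ℂ → ℂ} (hP₁ : L32 P₁) (hP₂ : L32 P₂) (hQ : L32 Q)
    (hK : L32 K) : tri (fun z => P₁ z + P₂ z) Q K = tri P₁ Q K + tri P₂ Q K := by
  rw [tri, tri, tri, ← integral_add (integrable_tri hP₁ hQ hK) (integrable_tri hP₂ hQ hK)]
  refine integral_congr_ae (.of_forall fun p => ?_)
  simp only
  ring

theorem density_rotate_sub (a : Circle) (f : Circle → ℂ) (z : ℂ) :
    density f f (a * z) - density f f z =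
      density (fun x => f (a * x) - f x) (fun x => f (a * x)) z +
        density (fun x => f (a * x) - f x) f z := by
  rw [← density_mul, density_sub_left, density_sub_left, density_comm f fun x => f (a * x)]
  ring

theorem norm₂_sq {f : Circle → ℂ} (hf : MemLp f 2 σ) :
    ∫ x, conj (f x) * f x ∂σ = ((norm₂ f ^ 2 : ℝ) : ℂ) := by
  have e : ∀ x, conj (f x) * f x = ((‖f x‖ ^ 2 : ℝ) : ℂ) := fun x => by
    rw [mul_comm, Complex.mul_conj, Complex.normSq_eq_norm_sq]
  simp_rw [e]
  rw [integral_complex_ofReal]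
  congr 1
  have h := hf.eLpNorm_eq_integral_rpow_norm (by simp) (by simp)
  rw [norm₂, h, ENNReal.toReal_ofReal (by positivity)]
  have h0 : 0 ≤ ∫ x, ‖f x‖ ^ 2 ∂σ := integral_nonneg fun _ => by positivity
  simp only [ENNReal.toReal_ofNat, Real.rpow_ofNat]
  rw [← Real.rpow_natCast, ← Real.rpow_mul h0]
  norm_num

theorem norm_exp_sub_one_le (t : ℝ) : ‖(Circle.exp t : ℂ) - 1‖ ≤ |t| := by
  rw [Circle.coe_exp, mul_comm]
  exact Real.norm_exp_I_mul_ofReal_sub_one_le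

/-- Of the three telescoped differences, two come from a function paired with itself and split in
two by `density_rotate_sub`, which makes five terms. Symmetry of `tri` puts the difference first and
leaves a function independent of `q` last. The rotation by `1` is written so that every term has the
shape required by `exists_norm_tri_rotate_sub_le`. -/
theorem EulerLagrange.integral_mul_rotate_sub_eq {f q : Circle → ℂ} {c : ℂ}
    (h : EulerLagrange c f) (hf : Measurable f) (hf' : MemLp f 2 σ) (hq : Measurable q)
    (hq' : MemLp q 2 σ) (a : Circle) :
    c * ∫ x, q x * (f (a * x) - f x) ∂σ =
      tri (density (fun x => f (a * x) - f x) fun x => f (a * x))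
        (density (reflect q) fun x => f (a * x))
        (fun z => density (tilde f) (tilde f) (a * z)) +
      tri (density (fun x => f (a * x) - f x) f) (density (reflect q) fun x => f (a * x))
        (fun z => density (tilde f) (tilde f) (a * z)) +
      tri (density (fun x => f (a * x) - f x) (reflect q)) (density f f)
        (fun z => density (tilde f) (tilde f) (a * z)) +
      (tri (density (fun x => tilde f (a * x) - tilde f x) fun x => tilde f (a * x))
        (density (reflect q) f) (fun z => density f f ((1 : Circle) * z)) +
      tri (density (fun x => tilde f (a * x) - tilde f x) (tilde f))
        (density (reflect q) f) (fun z => density f f ((1 : Circle) * z))) := by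
  have htm := measurable_tilde hf
  have ht' := memLp_tilde hf'
  have hP := L32_density hf hf hf' hf'
  have hK := L32_density htm htm ht' ht'
  have hDm : Measurable fun x => f (a * x) - f x := (measurable_rotate hf a).sub hf
  have hD' : MemLp (fun x => f (a * x) - f x) 2 σ := memLp_rotate_sub hf' a
  have hrm := measurable_reflect hq
  have hr' := memLp_reflect hq'
  have hfa := measurable_rotate hf a
  have hfa' : MemLp (fun x => f (a * x)) 2 σ :=
    hf'.comp_measurePreserving (measurePreserving_mul a)
  have hta := measurable_rotate htm a
  have hta' : MemLp (fun x => tilde f (a * x)) 2 σ :=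
    ht'.comp_measurePreserving (measurePreserving_mul a)
  have hQ := L32_density hrm hf hr' hf'
  have hQ' := L32_density hrm hfa hr' hfa'
  have hdtm : Measurable fun x => tilde f (a * x) - tilde f x := hta.sub htm
  have hdt' : MemLp (fun x => tilde f (a * x) - tilde f x) 2 σ := hta'.sub ht'
  have i1 : Integrable (fun x => q x * f (a * x)) σ := hq'.integrable_mul hfa'
  have i2 : Integrable (fun x => q x * f x) σ := hq'.integrable_mul hf'
  have e0 : ∫ x, q x * (f (a * x) - f x) ∂σ = ∫ x, q x * f (a * x) ∂σ - ∫ x, q x * f x ∂σ := by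
    rw [← integral_sub i1 i2]
    exact integral_congr_ae (.of_forall fun x => by simp only; ring)
  have e3 : (fun z => density (reflect q) (fun x => f (a * x)) z - density (reflect q) f z) =
      density (fun x => f (a * x) - f x) (reflect q) := by
    ext z; rw [← density_sub_right, density_comm]
  have e4 : (fun z => density f f (((1 : Circle) : ℂ) * z)) = density f f := by ext z; simp
  rw [e0, mul_sub, h.integral_rotate_eq hf hf' hq hq' a, h.integral_eq hf hf' hq hq',
    tri_sub_tri hP (hP.rotate a) hQ hQ' hK (hK.rotate a), e3, e4]
  simp only [density_rotate_sub]
  rw [tri_add_left (L32_density hDm hfa hD' hfa') (L32_density hDm hf hD' hf') hQ' (hK.rotate a),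
    tri_add_left (L32_density hdtm hta hdt' hta') (L32_density hdtm htm hdt' ht') hQ hP]

/-- Absorption: the choice of `ε` gives `5 ε N² ≤ C/2`, so after cancelling one factor `d` the `ε`
term is at most half of the left-hand side. The case `d = 0` is separate because of the
cancellation. -/
theorem le_of_mul_sq_le {C d ε A δ N : ℝ} (hC : 0 < C) (hd : 0 ≤ d) (hA : 0 ≤ A) (hδ : 0 ≤ δ)
    (hN : 0 ≤ N) (hε : ε = C / (10 * (N ^ 2 + 1)))
    (h : C * d ^ 2 ≤ 5 * ((ε * d + A * δ * N) * (N ^ 2 * d))) :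
    d ≤ 10 * A * N ^ 3 / C * δ := by
  rcases hd.eq_or_lt with h0 | h0
  · rw [← h0]; positivity
  have h5 : 5 * (ε * N ^ 2) ≤ C / 2 := by
    rw [hε, div_mul_eq_mul_div, mul_div_assoc', div_le_div_iff₀ (by positivity) (by norm_num)]
    nlinarith
  have h6 : C * d ≤ 5 * ((ε * d + A * δ * N) * N ^ 2) := by
    have : (C * d) * d ≤ 5 * ((ε * d + A * δ * N) * N ^ 2) * d := by linarith
    exact le_of_mul_le_mul_right this h0
  rw [div_mul_eq_mul_div, le_div_iff₀ hC]
  nlinarith [mul_le_mul_of_nonneg_right h5 h0.le]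

/-- Solutions of the Euler-Lagrange equation with nonzero multiplier are Lipschitz in `L²`. -/
theorem EulerLagrange.exists_norm₂_rotate_sub_le {f : Circle → ℂ} {c : ℂ} (hc : c ≠ 0)
    (h : EulerLagrange c f) (hf : Measurable f) (hf' : MemLp f 2 σ) :
    ∃ B : ℝ, 0 ≤ B ∧ ∀ a : Circle,
      norm₂ (fun x => f (a * x) - f x) ≤ B * ‖(a : ℂ) - 1‖ := by
  have htm := measurable_tilde hf
  have ht' := memLp_tilde hf'
  set P := density f f with hPdef
  set K := density (tilde f) (tilde f) with hKdef
  have hP : L32 P := L32_density hf hf hf' hf'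
  have hK : L32 K := L32_density htm htm ht' ht'
  set N := norm₂ f with hN
  have hN0 : 0 ≤ N := norm₂_nonneg f
  have hc' : 0 < ‖c‖ := norm_pos_iff.2 hc
  set ε : ℝ := ‖c‖ / (10 * (N ^ 2 + 1)) with hε
  have hε0 : 0 < ε := by positivity
  obtain ⟨A₁, hA₁, H₁⟩ := exists_norm_tri_rotate_sub_le hK hε0
  obtain ⟨A₂, hA₂, H₂⟩ := exists_norm_tri_rotate_sub_le hP hε0
  set A := A₁ + A₂ with hA
  refine ⟨10 * A * N ^ 3 / ‖c‖, by positivity, fun a => ?_⟩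
  set D : Circle → ℂ := fun x => f (a * x) - f x with hD
  have hDm : Measurable D := (measurable_rotate hf a).sub hf
  have hD' : MemLp D 2 σ := memLp_rotate_sub hf' a
  set d := norm₂ D with hd
  have hd0 : 0 ≤ d := norm₂_nonneg D
  set δ := ‖(a : ℂ) - 1‖ with hδ
  have hδ0 : 0 ≤ δ := norm_nonneg _
  -- This test function makes the pairing with `D` equal to `‖D‖²`.
  set q : Circle → ℂ := fun x => conj (D x) with hq
  have hqm : Measurable q := Complex.continuous_conj.measurable.comp hDm
  have hq' : MemLp q 2 σ := hD'.star
  have hrm := measurable_reflect hqm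
  have hr' := memLp_reflect hq'
  have hnq : norm₂ (reflect q) = d := by
    rw [norm₂_reflect hq', hd, norm₂, norm₂]
    congr 1
    exact eLpNorm_congr_norm_ae (.of_forall fun x => by simp [hq])
  have hfa := measurable_rotate hf a
  have hfa' : MemLp (fun x => f (a * x)) 2 σ :=
    hf'.comp_measurePreserving (measurePreserving_mul a)
  have hta := measurable_rotate htm a
  have hta' : MemLp (fun x => tilde f (a * x)) 2 σ :=
    ht'.comp_measurePreserving (measurePreserving_mul a)
  have hDt : (fun x => tilde f (a * x) - tilde f x) = tilde D := by
    ext x; simp [tilde, hD]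
  have hndt : norm₂ (fun x => tilde f (a * x) - tilde f x) = d := by
    rw [hDt, norm₂_tilde hD']
  have hNa : norm₂ (fun x => f (a * x)) = N := norm₂_rotate hf' a
  have hNt : norm₂ (tilde f) = N := norm₂_tilde hf'
  have hNta : norm₂ (fun x => tilde f (a * x)) = N := (norm₂_rotate ht' a).trans hNt
  -- In each of the five terms the three functions besides the difference are the reflected `q`, of
  -- norm `d`, and two copies of `f` or `tilde f`, possibly rotated, of norm `N`. The common factor
  -- is thus `N² d`.
  have b1 := H₁ a a f _ _ _ hf hfa hrm hfa hf' hfa' hr' hfa'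
  have b2 := H₁ a a f _ _ _ hf hf hrm hfa hf' hf' hr' hfa'
  have b3 := H₁ a a f _ _ _ hf hrm hf hf hf' hr' hf' hf'
  have b4 := H₂ 1 a _ _ _ _ htm hta hrm hf ht' hta' hr' hf'
  have b5 := H₂ 1 a _ _ _ _ htm htm hrm hf ht' ht' hr' hf'
  rw [hndt, hnq, hNt, ← hN] at b4 b5
  rw [hNta] at b4
  change _ ≤ (ε * d + _) * _ at b1 b2 b3
  rw [hnq, ← hN] at b1 b2 b3
  rw [hNa] at b1 b2
  have main := h.integral_mul_rotate_sub_eq hf hf' hqm hq' a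
  rw [show (∫ x, q x * (f (a * x) - f x) ∂σ) = ((d ^ 2 : ℝ) : ℂ) from norm₂_sq hD'] at main
  refine le_of_mul_sq_le hc' hd0 (by positivity) hδ0 hN0 hε ?_
  have e : ‖c‖ * d ^ 2 = ‖c * ((d ^ 2 : ℝ) : ℂ)‖ := by
    rw [norm_mul, Complex.norm_real, Real.norm_of_nonneg (by positivity)]
  rw [e, main]
  have hA1 : A₁ * δ * N ≤ A * δ * N := by gcongr; linarith
  have hA2 : A₂ * δ * N ≤ A * δ * N := by gcongr; linarith
  have g1 : (ε * d + A₁ * δ * N) * (N ^ 2 * d) ≤ (ε * d + A * δ * N) * (N ^ 2 * d) := by gcongr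
  have g2 : (ε * d + A₂ * δ * N) * (N ^ 2 * d) ≤ (ε * d + A * δ * N) * (N ^ 2 * d) := by gcongr
  refine (norm_add_le _ _).trans ((add_le_add ((norm_add₃_le).trans
    (add_le_add_three b1 b2 b3)) ((norm_add_le _ _).trans (add_le_add b4 b5))).trans ?_)
  linarith

/-! ### The multiplier zero. -/

theorem density_tilde (f : Circle → ℂ) (z : ℂ) :
    density (tilde f) (tilde f) z = conj (density f f (-z)) := by
  have h := density_mul (-1) f f z
  have e : (((-1 : Circle) : Circle) : ℂ) * z = -z := by simp [Circle.coe_neg]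
  rw [e] at h
  rw [← h]
  simp [density, fold, tilde]

/-- The density of `fσ ∗ fσ ∗ fσ`. -/
noncomputable def tripleDensity (f : Circle → ℂ) (z : ℂ) : ℂ :=
  ∫ y, f y * density f f (z - y) ∂σ

theorem measurable_triple_integrand {f : Circle → ℂ} (hf : Measurable f) :
    Measurable fun p : ℂ × Circle × Circle =>
      conj (f p.2.1 * density f f (p.1 - p.2.1)) * (f p.2.2 * density f f (p.1 - p.2.2)) := by
  have hP := measurable_density hf hf
  have m1 : Measurable fun p : ℂ × Circle × Circle => p.2.1 := measurable_fst.comp measurable_snd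
  have m2 : Measurable fun p : ℂ × Circle × Circle => p.2.2 := measurable_snd.comp measurable_snd
  exact (Complex.continuous_conj.measurable.comp ((hf.comp m1).mul
    (hP.comp (measurable_fst.sub (measurable_coe_circle.comp m1))))).mul ((hf.comp m2).mul
    (hP.comp (measurable_fst.sub (measurable_coe_circle.comp m2))))

theorem measurePreserving_neg_fst : MeasurePreserving
    (fun p : Circle × Circle => (-p.1, p.2)) (σ.prod σ) (σ.prod σ) :=
  measurePreserving_neg.prod (.id σ)

theorem measurableEmbedding_neg_fst :
    MeasurableEmbedding (fun p : Circle × Circle => (-p.1, p.2)) :=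
  (Homeomorph.neg Circle).measurableEmbedding.prodMap .id

/-- After the shift by `y`, the two densities in the square of `tripleDensity` have arguments `z`
and, through `tilde`, `-z - (-x + y)`, which is the pattern of `tri`. -/
theorem triple_integrand_shift (f : Circle → ℂ) (x y : Circle) (z : ℂ) :
    conj (f x * density f f (z + y - x)) * (f y * density f f (z + y - y)) =
      tilde f (-x) * f y * (density f f z *
        density (tilde f) (tilde f) (-z - (((-x : Circle) : ℂ) + y))) := by
  rw [density_tilde, add_sub_cancel_right, map_mul, tilde, neg_neg, Circle.coe_neg,
    show -(-z - (-(x : ℂ) + y)) = z + y - x by ring]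
  ring

theorem integrable_triple_integrand {f : Circle → ℂ} (hf : Measurable f) (hf' : MemLp f 2 σ) :
    Integrable (fun p : ℂ × Circle × Circle =>
      conj (f p.2.1 * density f f (p.1 - p.2.1)) * (f p.2.2 * density f f (p.1 - p.2.2)))
      (volume.prod (σ.prod σ)) := by
  have hm := measurable_triple_integrand hf
  have htm := measurable_tilde hf
  have ht' := memLp_tilde hf'
  refine ⟨hm.aestronglyMeasurable, ?_⟩
  rw [HasFiniteIntegral, lintegral_prod_symm _ hm.enorm.aemeasurable]
  refine lt_of_le_of_lt (le_of_eq ?_) (lintegral_comp_add_lt_top htm hf ht' hf'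
    (L32_density hf hf hf' hf') (L32_density htm htm ht' ht'))
  rw [← measurePreserving_neg_fst.lintegral_comp_emb measurableEmbedding_neg_fst]
  refine lintegral_congr fun p => ?_
  rw [← lintegral_const_mul' _ _ (ENNReal.mul_ne_top enorm_ne_top enorm_ne_top),
    ← lintegral_add_right_eq_self _ (p.2 : ℂ)]
  refine lintegral_congr fun z => ?_
  simp only
  rw [triple_integrand_shift, enorm_mul, enorm_mul, enorm_mul, neg_neg]

/-- The right-hand side of the weak equation with test function `conj f` is the squared `L²` norm of
`fσ ∗ fσ ∗ fσ`. -/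
theorem integral_triple_integrand {f : Circle → ℂ} (hf : Measurable f) (hf' : MemLp f 2 σ) :
    ∫ z, conj (tripleDensity f z) * tripleDensity f z =
      tri (density f f) (density (tilde f) f) (density (tilde f) (tilde f)) := by
  have htm := measurable_tilde hf
  have ht' := memLp_tilde hf'
  have hi := integrable_triple_integrand hf hf'
  rw [← integral_comp_add_eq_tri htm hf ht' hf' (L32_density hf hf hf' hf')
    (L32_density htm htm ht' ht')]
  calc _ = ∫ p : ℂ × Circle × Circle, conj (f p.2.1 * density f f (p.1 - p.2.1)) *
        (f p.2.2 * density f f (p.1 - p.2.2)) ∂(volume.prod (σ.prod σ)) := by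
        rw [integral_prod _ hi]
        refine integral_congr_ae (.of_forall fun z => ?_)
        simp only
        rw [integral_prod_mul (fun x : Circle => conj (f x * density f f (z - x)))
          (fun y : Circle => f y * density f f (z - y)), tripleDensity, ← integral_conj]
    _ = _ := by
        rw [integral_prod_symm _ hi,
          ← measurePreserving_neg_fst.integral_comp measurableEmbedding_neg_fst]
        refine integral_congr_ae (.of_forall fun p => ?_)
        simp only
        rw [← integral_const_mul, ← integral_add_right_eq_self _ (p.2 : ℂ)]
        refine integral_congr_ae (.of_forall fun z => ?_)
        simp only
        rw [triple_integrand_shift, neg_neg]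

theorem tripleDensity_ae_eq_zero {f : Circle → ℂ} (hf : Measurable f) (hf' : MemLp f 2 σ)
    (h : tri (density f f) (density (tilde f) f) (density (tilde f) (tilde f)) = 0) :
    tripleDensity f =ᵐ[volume] 0 := by
  have e : ∀ z, conj (tripleDensity f z) * tripleDensity f z =
      ((‖tripleDensity f z‖ ^ 2 : ℝ) : ℂ) := fun z => by
    rw [mul_comm, Complex.mul_conj, Complex.normSq_eq_norm_sq]
  have hint : Integrable fun z => conj (tripleDensity f z) * tripleDensity f z := by
    refine (integrable_triple_integrand hf hf').integral_prod_left.congr (.of_forall fun z => ?_)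
    simp only
    rw [integral_prod_mul (fun x : Circle => conj (f x * density f f (z - x)))
      (fun y : Circle => f y * density f f (z - y)), tripleDensity, ← integral_conj]
  rw [← integral_triple_integrand hf hf'] at h
  simp_rw [e] at h
  rw [funext e] at hint
  rw [integral_complex_ofReal, Complex.ofReal_eq_zero] at h
  have hr : Integrable fun z => ‖tripleDensity f z‖ ^ 2 := by
    simpa only [RCLike.re_eq_complex_re, Complex.ofReal_re] using hint.re
  rw [integral_eq_zero_iff_of_nonneg (fun z => by positivity) hr] at h
  filter_upwards [h] with z hz
  simpa using hz

/-- The unitary characters of the plane. -/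
noncomputable def planeChar (ξ z : ℂ) : ℂ := Complex.exp (inner ℝ z ξ * Complex.I)

theorem continuous_planeChar (ξ : ℂ) : Continuous (planeChar ξ) := by
  unfold planeChar
  fun_prop

theorem norm_planeChar (ξ z : ℂ) : ‖planeChar ξ z‖ = 1 := Complex.norm_exp_ofReal_mul_I _

theorem planeChar_add (ξ z w : ℂ) : planeChar ξ (z + w) = planeChar ξ z * planeChar ξ w := by
  rw [planeChar, planeChar, planeChar, ← Complex.exp_add, inner_add_left]
  congr 1; push_cast; ring

theorem conj_planeChar (ξ z : ℂ) : conj (planeChar ξ z) = planeChar (-ξ) z := by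
  rw [planeChar, planeChar, ← Complex.exp_conj, inner_neg_right]
  simp only [map_mul, Complex.conj_ofReal, Complex.conj_I, Complex.ofReal_neg, mul_neg, neg_mul]

theorem integral_tripleDensity_mul_planeChar {f : Circle → ℂ} (hf : Measurable f)
    (hf' : MemLp f 2 σ) (ξ : ℂ) :
    ∫ z, tripleDensity f z * planeChar ξ z = (∫ x, f x * planeChar ξ x ∂σ) ^ 3 := by
  have hfi := integrable_of_memLp_two hf'
  have hP := integrable_density hfi hfi
  have hPm := measurable_density hf hf
  have hcm := (continuous_planeChar ξ).measurable
  set S : Circle × ℂ → ℂ := fun p => f p.1 * (density f f (p.2 - p.1) * planeChar ξ p.2) with hS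
  have hSm : Measurable S := (hf.comp measurable_fst).mul
    ((hPm.comp (measurable_snd.sub (measurable_coe_circle.comp measurable_fst))).mul
      (hcm.comp measurable_snd))
  have hPs : ∀ y : Circle, Integrable fun z => density f f (z - y) * planeChar ξ z := fun y =>
    (hP.comp_sub_right (y : ℂ)).mul_bdd (c := 1) hcm.aestronglyMeasurable
      (.of_forall fun z => (norm_planeChar ξ z).le)
  have hSi : Integrable S (σ.prod volume) := by
    rw [integrable_prod_iff hSm.aestronglyMeasurable]
    refine ⟨.of_forall fun y => (hPs y).const_mul (f y), ?_⟩
    have : (fun y : Circle => ∫ z, ‖S (y, z)‖) = fun y => ‖f y‖ * ∫ z, ‖density f f z‖ := by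
      ext y
      simp only [hS, norm_mul, norm_planeChar, mul_one]
      rw [integral_const_mul, integral_sub_right_eq_self (fun z => ‖density f f z‖)]
    rw [this]
    exact hfi.norm.mul_const _
  have hsq : ∫ z, density f f z * planeChar ξ z = (∫ x, f x * planeChar ξ x ∂σ) ^ 2 := by
    rw [(integral_density_mul hfi hfi (continuous_planeChar ξ)).2, sq, ← integral_prod_mul]
    refine integral_congr_ae (.of_forall fun p => ?_)
    simp only [planeChar_add]; ring
  calc _ = ∫ z, (∫ y, S (y, z) ∂σ) := by
        refine integral_congr_ae (.of_forall fun z => ?_)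
        simp only [tripleDensity, hS]
        rw [← integral_mul_const]
        exact integral_congr_ae (.of_forall fun y => by simp only; ring)
    _ = ∫ y, (∫ z, S (y, z)) ∂σ := (integral_integral_swap (f := fun y z => S (y, z)) hSi).symm
    _ = ∫ y, (f y * planeChar ξ y) * (∫ z, density f f z * planeChar ξ z) ∂σ := by
        refine integral_congr_ae (.of_forall fun y => ?_)
        simp only [hS]
        rw [integral_const_mul, mul_assoc]
        congr 1
        rw [← integral_add_right_eq_self _ (y : ℂ), ← integral_const_mul]
        refine integral_congr_ae (.of_forall fun z => ?_)
        simp only [planeChar_add, add_sub_cancel_right]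
        ring
    _ = _ := by rw [integral_mul_const, hsq]; ring

theorem measurableEmbedding_coe_circle : MeasurableEmbedding fun x : Circle => (x : ℂ) :=
  (Continuous.isClosedEmbedding (X := Circle) (f := fun x : Circle => (x : ℂ)) (by fun_prop)
    Circle.coe_injective).measurableEmbedding

/-- The positive and negative parts of `r` define finite measures on the plane with the same
characteristic function, so the measures agree; the two parts have disjoint supports and must both
vanish. -/
theorem ae_eq_zero_of_integral_planeChar_real {r : Circle → ℝ} (hr : Measurable r)
    (hi : Integrable r σ) (h : ∀ ξ, ∫ x, (r x : ℂ) * planeChar ξ x ∂σ = 0) : r =ᵐ[σ] 0 := by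
  have hbdd : ∀ {g : Circle → ℝ}, Integrable g σ → ∀ ξ,
      Integrable (fun x => (g x : ℂ) * planeChar ξ x) σ := fun hg ξ =>
    hg.ofReal.mul_bdd (c := 1)
      ((continuous_planeChar ξ).measurable.comp measurable_coe_circle).aestronglyMeasurable
      (.of_forall fun z => (norm_planeChar ξ z).le)
  have hchar : ∀ {g : Circle → ℝ}, Measurable g → ∀ ξ : ℂ,
      charFun ((σ.withDensity fun x => ENNReal.ofReal (g x)).map fun x : Circle => (x : ℂ)) ξ =
        ∫ x, ((max (g x) 0 : ℝ) : ℂ) * planeChar ξ x ∂σ := by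
    intro g hg ξ
    rw [charFun_apply, measurableEmbedding_coe_circle.integral_map,
      integral_withDensity_eq_integral_toReal_smul hg.ennreal_ofReal (.of_forall fun x => by simp)]
    refine integral_congr_ae (.of_forall fun x => ?_)
    simp only [ENNReal.toReal_ofReal', Complex.real_smul, planeChar]
  have hn : Integrable (fun x => -r x) σ := hi.neg
  have hrn : Measurable fun x => -r x := hr.neg
  have : IsFiniteMeasure (σ.withDensity fun x => ENNReal.ofReal (r x)) :=
    isFiniteMeasure_withDensity_ofReal hi.2
  have : IsFiniteMeasure (σ.withDensity fun x => ENNReal.ofReal (-r x)) :=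
    isFiniteMeasure_withDensity_ofReal hn.2
  have heq : (σ.withDensity fun x => ENNReal.ofReal (r x)).map (fun x : Circle => (x : ℂ)) =
      (σ.withDensity fun x => ENNReal.ofReal (-r x)).map (fun x : Circle => (x : ℂ)) := by
    refine Measure.ext_of_charFun (funext fun ξ => ?_)
    rw [hchar hr, hchar hrn, ← sub_eq_zero, ← integral_sub (hbdd hi.pos_part ξ)
      (hbdd hn.pos_part ξ), ← h ξ]
    refine integral_congr_ae (.of_forall fun x => ?_)
    simp only
    rw [← sub_mul, ← Complex.ofReal_sub, max_zero_sub_max_neg_zero_eq_self]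
  have heq2 : σ.withDensity (fun x => ENNReal.ofReal (r x)) =
      σ.withDensity fun x => ENNReal.ofReal (-r x) := by
    rw [← measurableEmbedding_coe_circle.comap_map (σ.withDensity fun x => ENNReal.ofReal (r x)),
      heq, measurableEmbedding_coe_circle.comap_map]
  rw [withDensity_eq_iff hr.ennreal_ofReal.aemeasurable hrn.ennreal_ofReal.aemeasurable
    (by simpa using (hi.lintegral_lt_top).ne)] at heq2
  filter_upwards [heq2] with x hx
  rcases le_total 0 (r x) with h0 | h0
  · rw [ENNReal.ofReal_of_nonpos (p := -r x) (by linarith), ENNReal.ofReal_eq_zero] at hx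
    exact le_antisymm hx h0
  · rw [ENNReal.ofReal_of_nonpos h0, eq_comm, ENNReal.ofReal_eq_zero] at hx
    exact le_antisymm h0 (by simpa using hx)

theorem ae_eq_zero_of_integral_planeChar {f : Circle → ℂ} (hf : Measurable f)
    (hi : Integrable f σ) (h : ∀ ξ, ∫ x, f x * planeChar ξ x ∂σ = 0) : f =ᵐ[σ] 0 := by
  have hbdd : ∀ {g : Circle → ℂ}, Integrable g σ → ∀ ξ,
      Integrable (fun x => g x * planeChar ξ x) σ := fun hg ξ =>
    hg.mul_bdd (c := 1)
      ((continuous_planeChar ξ).measurable.comp measurable_coe_circle).aestronglyMeasurable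
      (.of_forall fun z => (norm_planeChar ξ z).le)
  have hci : Integrable (fun x => conj (f x)) σ :=
    Complex.conjCLE.toContinuousLinearMap.integrable_comp hi
  -- Conjugating the hypothesis at `-ξ` allows the real and imaginary parts to be treated
  -- separately.
  have hc : ∀ ξ, ∫ x, conj (f x) * planeChar ξ x ∂σ = 0 := by
    intro ξ
    rw [← map_zero (starRingEnd ℂ), ← h (-ξ), ← integral_conj]
    refine integral_congr_ae (.of_forall fun x => ?_)
    simp only [map_mul, conj_planeChar, neg_neg]
  have hre := ae_eq_zero_of_integral_planeChar_real (r := fun x => (f x).re)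
    (Complex.measurable_re.comp hf) hi.re fun ξ => by
      have : ∀ x : Circle, ((f x).re : ℂ) * planeChar ξ x =
          (1 / 2) * (f x * planeChar ξ x + conj (f x) * planeChar ξ x) := fun x => by
        rw [Complex.re_eq_add_conj]; ring
      simp_rw [this]
      rw [integral_const_mul, integral_add (hbdd hi ξ) (hbdd hci ξ), h, hc]; simp
  have him := ae_eq_zero_of_integral_planeChar_real (r := fun x => (f x).im)
    (Complex.measurable_im.comp hf) hi.im fun ξ => by
      have : ∀ x : Circle, ((f x).im : ℂ) * planeChar ξ x =
          (1 / (2 * Complex.I)) * (f x * planeChar ξ x - conj (f x) * planeChar ξ x) := fun x => by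
        rw [Complex.im_eq_sub_conj]; ring
      simp_rw [this]
      rw [integral_const_mul, integral_sub (hbdd hi ξ) (hbdd hci ξ), h, hc]; simp
  filter_upwards [hre, him] with x h1 h2
  exact Complex.ext h1 h2

/-- For the multiplier zero, the Euler-Lagrange equation has only the trivial solution. -/
theorem EulerLagrange.ae_eq_zero {f : Circle → ℂ} (h : EulerLagrange 0 f) (hf : Measurable f)
    (hf' : MemLp f 2 σ) : f =ᵐ[σ] 0 := by
  have hq : Measurable fun x => conj (f x) := Complex.continuous_conj.measurable.comp hf
  -- For the test function `conj f`, the reflected function is `tilde f` by definition.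
  have h1 := h.integral_eq hf hf' hq hf'.star
  rw [zero_mul] at h1
  have h2 := tripleDensity_ae_eq_zero hf hf' h1.symm
  refine ae_eq_zero_of_integral_planeChar hf (integrable_of_memLp_two hf') fun ξ => ?_
  have h3 := integral_tripleDensity_mul_planeChar hf hf' ξ
  rw [integral_congr_ae (g := fun _ => 0) (by filter_upwards [h2] with z hz; simp [hz]),
    integral_zero] at h3
  exact pow_eq_zero_iff (by norm_num) |>.1 h3.symm

/-! ### From the Lipschitz bound to the Hölder norm. -/

theorem EulerLagrange.exists_eLpNorm_rotate_sub_le {c : ℂ} {f : Circle → ℂ}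
    (h : EulerLagrange c f) (hf : Measurable f) (hf' : MemLp f 2 σ) :
    ∃ B : ℝ, 0 ≤ B ∧ ∀ t : ℝ,
      eLpNorm (fun x => rotate t f x - f x) 2 σ ≤ ENNReal.ofReal (B * |t|) := by
  by_cases hc : c = 0
  · subst hc
    have h0 := h.ae_eq_zero hf hf'
    refine ⟨0, le_rfl, fun t => ?_⟩
    have h1 := (measurePreserving_mul (Circle.exp t)).quasiMeasurePreserving.ae h0
    rw [eLpNorm_congr_ae (g := 0) (by
      filter_upwards [h0, h1] with x hx hy
      simp only [Pi.zero_apply] at hx hy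
      simp [rotate, hx, hy])]
    simp
  · obtain ⟨B, hB, hBa⟩ := h.exists_norm₂_rotate_sub_le hc hf hf'
    refine ⟨B, hB, fun t => ?_⟩
    have hm : MemLp (fun x => rotate t f x - f x) 2 σ := memLp_rotate_sub hf' (Circle.exp t)
    rw [ENNReal.le_ofReal_iff_toReal_le hm.2.ne (by positivity)]
    exact (hBa (Circle.exp t)).trans (by gcongr; exact norm_exp_sub_one_le t)

theorem memCalH_half {f : Circle → ℂ} (hf' : MemLp f 2 σ) {B : ℝ}
    (h : ∀ t : ℝ, eLpNorm (fun x => rotate t f x - f x) 2 σ ≤ ENNReal.ofReal (B * |t|))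
    (hB : 0 ≤ B) : MemCalH (1 / 2) f := by
  refine ⟨hf', ENNReal.add_lt_top.2 ⟨hf'.2, lt_of_le_of_lt ?_ (ENNReal.ofReal_lt_top (r := B))⟩⟩
  refine iSup₂_le fun t ht => ENNReal.div_le_of_le_mul ((h t).trans ?_)
  rw [← ENNReal.ofReal_mul hB]
  refine ENNReal.ofReal_le_ofReal (mul_le_mul_of_nonneg_left ?_ hB)
  simpa using Real.rpow_le_rpow_of_exponent_ge ht.1 ht.2 (show (1 / 2 : ℝ) ≤ 1 by norm_num)

/-! ### Fourier coefficients and the Sobolev bound. -/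

theorem σ_univ : σ Set.univ = ENNReal.ofReal (2 * Real.pi) := by
  rw [σ, Measure.map_apply Circle.exp.continuous.measurable .univ, Set.preimage_univ,
    Measure.restrict_apply_univ, Real.volume_Ioc]
  congr 1; ring

/-- Rotation by `π / n` preserves the integral and changes the sign of the integrand. -/
theorem integral_zpow {n : ℤ} (hn : n ≠ 0) : ∫ x : Circle, (x : ℂ) ^ n ∂σ = 0 := by
  have h := integral_mul_left_eq_self (μ := σ) (fun x : Circle => (x : ℂ) ^ n)
    (Circle.exp (Real.pi / n))
  have e : ((Circle.exp (Real.pi / n) : Circle) : ℂ) ^ n = -1 := by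
    rw [Circle.coe_exp, ← Complex.exp_int_mul, ← Complex.exp_pi_mul_I]
    congr 1
    have : (n : ℂ) ≠ 0 := by exact_mod_cast hn
    push_cast; field_simp
  simp only [Circle.coe_mul, mul_zpow, e, neg_mul, one_mul, integral_neg] at h
  linear_combination (-1 / 2) * h

theorem continuous_zpow (n : ℤ) : Continuous fun x : Circle => (x : ℂ) ^ n :=
  Continuous.zpow₀ (by fun_prop) n fun x => .inl x.coe_ne_zero

theorem norm_coe_zpow (n : ℤ) (x : Circle) : ‖(x : ℂ) ^ n‖ = 1 := by
  rw [norm_zpow, Circle.norm_coe, one_zpow]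

theorem memLp_zpow (n : ℤ) : MemLp (fun x : Circle => (x : ℂ) ^ n) 2 σ :=
  MemLp.of_bound (continuous_zpow n).measurable.aestronglyMeasurable 1
    (.of_forall fun x => (norm_coe_zpow n x).le)

/-- The trigonometric monomials, normalized in `L²`. -/
noncomputable def trigLp (n : ℤ) : Lp ℂ 2 σ :=
  ((1 / √(2 * Real.pi) : ℝ) : ℂ) • (memLp_zpow n).toLp

theorem inner_trigLp (n : ℤ) {g : Circle → ℂ} (hg : MemLp g 2 σ) :
    inner ℂ (trigLp n) hg.toLp = (√(2 * Real.pi) : ℂ) * fourierCoefficient g n := by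
  have hs : (√(2 * Real.pi) : ℂ) ≠ 0 := by
    rw [Complex.ofReal_ne_zero]; positivity
  have hp : (√(2 * Real.pi) : ℂ) ^ 2 = 2 * Real.pi := by
    rw [← Complex.ofReal_pow, Real.sq_sqrt (by positivity)]; push_cast; rfl
  rw [trigLp, inner_smul_left, L2.inner_def, fourierCoefficient, ← hp]
  have : ∫ a, inner ℂ ((memLp_zpow n).toLp _ a) (hg.toLp g a) ∂σ =
      ∫ x : Circle, (x : ℂ) ^ (-n) * g x ∂σ := by
    refine integral_congr_ae ?_
    filter_upwards [(memLp_zpow n).coeFn_toLp, hg.coeFn_toLp] with x hx hy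
    rw [hx, hy, RCLike.inner_apply, map_zpow₀, ← Circle.coe_inv_eq_conj, mul_comm, zpow_neg,
      Circle.coe_inv, inv_zpow]
  rw [this, Complex.conj_ofReal]
  push_cast
  field_simp

theorem fourierCoefficient_zpow (n m : ℤ) :
    fourierCoefficient (fun x : Circle => (x : ℂ) ^ m) n = if n = m then 1 else 0 := by
  have e : ∀ x : Circle, (x : ℂ) ^ (-n) * (x : ℂ) ^ m = (x : ℂ) ^ (m - n) := fun x => by
    rw [← zpow_add₀ x.coe_ne_zero]; congr 1; ring
  simp only [fourierCoefficient, e]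
  split_ifs with h
  · subst h
    have : (σ.real Set.univ : ℂ) = 2 * Real.pi := by
      rw [measureReal_def, σ_univ, ENNReal.toReal_ofReal (by positivity)]; push_cast; rfl
    have hp : (Real.pi : ℂ) ≠ 0 := by exact_mod_cast Real.pi_ne_zero
    simp [this]
    field_simp
  · rw [integral_zpow (by omega), mul_zero]

theorem orthonormal_trigLp : Orthonormal ℂ trigLp := by
  rw [orthonormal_iff_ite]
  intro n m
  have hs : (√(2 * Real.pi) : ℂ) ≠ 0 := by
    rw [Complex.ofReal_ne_zero]; positivity
  rw [show trigLp m = ((1 / √(2 * Real.pi) : ℝ) : ℂ) • (memLp_zpow m).toLp from rfl,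
    inner_smul_right, inner_trigLp, fourierCoefficient_zpow]
  push_cast
  field_simp

/-- Bessel's inequality on the circle. -/
theorem sum_sq_fourierCoefficient_le {g : Circle → ℂ} (hg : MemLp g 2 σ) (s : Finset ℤ) :
    ∑ n ∈ s, ‖fourierCoefficient g n‖ ^ 2 ≤ norm₂ g ^ 2 := by
  have h := orthonormal_trigLp.sum_inner_products_le hg.toLp (s := s)
  rw [Lp.norm_toLp] at h
  refine le_trans (Finset.sum_le_sum fun n _ => ?_) h
  rw [inner_trigLp, norm_mul, mul_pow, Complex.norm_real, Real.norm_eq_abs, sq_abs,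
    Real.sq_sqrt (by positivity)]
  -- The normalization leaves a factor `2π ≥ 1`, which is dropped.
  nlinarith [Real.pi_gt_three, sq_nonneg ‖fourierCoefficient g n‖]

theorem fourierCoefficient_rotate_sub {f : Circle → ℂ} (hf' : MemLp f 2 σ) (a : Circle)
    (n : ℤ) : fourierCoefficient (fun x => f (a * x) - f x) n =
      ((a : ℂ) ^ n - 1) * fourierCoefficient f n := by
  have hi : ∀ {g : Circle → ℂ}, MemLp g 2 σ →
      Integrable (fun x : Circle => (x : ℂ) ^ (-n) * g x) σ := fun hg =>
    (integrable_of_memLp_two hg).bdd_mul (c := 1)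
      (continuous_zpow (-n)).measurable.aestronglyMeasurable
      (.of_forall fun x => (norm_coe_zpow (-n) x).le)
  have hr : MemLp (fun x => f (a * x)) 2 σ := hf'.comp_measurePreserving (measurePreserving_mul a)
  have h := integral_mul_left_eq_self (μ := σ) (fun x : Circle => (x : ℂ) ^ (-n) * f x) a
  have e : ∫ x : Circle, (x : ℂ) ^ (-n) * f (a * x) ∂σ =
      (a : ℂ) ^ n * ∫ x : Circle, (x : ℂ) ^ (-n) * f x ∂σ := by
    rw [← h, ← integral_const_mul]
    refine integral_congr_ae (.of_forall fun x => ?_)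
    simp only [Circle.coe_mul, mul_zpow, zpow_neg]
    have := zpow_ne_zero n a.coe_ne_zero
    field_simp
  simp only [fourierCoefficient, mul_sub]
  rw [integral_sub (hi hr) (hi hf'), e]
  ring

theorem tendsto_norm_exp_zpow_sub_one_div (n : ℤ) :
    Filter.Tendsto (fun t : ℝ => ‖((Circle.exp t : Circle) : ℂ) ^ n - 1‖ ^ 2 / t ^ 2)
      (nhdsWithin 0 {0}ᶜ) (nhds ((n : ℝ) ^ 2)) := by
  have hd : HasDerivAt (fun t : ℝ => Complex.exp (n * (t * Complex.I))) (n * Complex.I) 0 := by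
    have h1 : HasDerivAt (fun t : ℝ => (n : ℂ) * ((t : ℂ) * Complex.I)) (n * (1 * Complex.I)) 0 :=
      ((Complex.ofRealCLM.hasDerivAt (x := 0)).mul_const Complex.I).const_mul (n : ℂ)
    simpa using h1.cexp
  have := (hasDerivAt_iff_tendsto_slope.1 hd).norm.pow 2
  have e : ‖(n : ℂ) * Complex.I‖ ^ 2 = (n : ℝ) ^ 2 := by simp
  rw [e] at this
  refine this.congr fun t => ?_
  rw [slope_def_module, norm_smul, sub_zero, Circle.coe_exp, ← Complex.exp_int_mul, mul_pow]
  simp [div_eq_inv_mul]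

/-- Bessel's inequality for `f ∘ R_t - f` bounds the finite sum of `|exp (int) - 1|² |f̂(n)|²` by
`B² t²`. Dividing by `t²` and letting `t → 0` produces the weights `n²`. -/
theorem sum_sq_mul_sq_fourierCoefficient_le {f : Circle → ℂ} (hf' : MemLp f 2 σ) {B : ℝ}
    (h : ∀ t : ℝ, eLpNorm (fun x => rotate t f x - f x) 2 σ ≤ ENNReal.ofReal (B * |t|))
    (hB : 0 ≤ B) (s : Finset ℤ) :
    ∑ n ∈ s, (n : ℝ) ^ 2 * ‖fourierCoefficient f n‖ ^ 2 ≤ B ^ 2 := by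
  refine le_of_tendsto (tendsto_finsetSum s fun n _ =>
    (tendsto_norm_exp_zpow_sub_one_div n).mul_const (‖fourierCoefficient f n‖ ^ 2)) ?_
  filter_upwards [self_mem_nhdsWithin] with t ht
  have ht' : 0 < t ^ 2 := by have : t ≠ 0 := ht; positivity
  have h1 := sum_sq_fourierCoefficient_le (memLp_rotate_sub hf' (Circle.exp t)) s
  have h2 : norm₂ (fun x => f (Circle.exp t * x) - f x) ≤ B * |t| :=
    ENNReal.toReal_le_of_le_ofReal (by positivity) (h t)
  have h3 : norm₂ (fun x => f (Circle.exp t * x) - f x) ^ 2 ≤ B ^ 2 * t ^ 2 := by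
    rw [← sq_abs t, ← mul_pow]
    exact pow_le_pow_left₀ ENNReal.toReal_nonneg h2 2
  simp only [fourierCoefficient_rotate_sub hf', norm_mul, mul_pow] at h1
  simp only [div_mul_eq_mul_div]
  rw [← Finset.sum_div, div_le_iff₀ ht']
  exact h1.trans h3

theorem memSobolev_of_lipschitz {f : Circle → ℂ} (hf' : MemLp f 2 σ) {B : ℝ}
    (h : ∀ t : ℝ, eLpNorm (fun x => rotate t f x - f x) 2 σ ≤ ENNReal.ofReal (B * |t|))
    (hB : 0 ≤ B) {t : ℝ} (ht : t ≤ 1) : MemSobolev t f := by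
  refine ⟨hf', summable_of_sum_le (c := norm₂ f ^ 2 + B ^ 2) (fun n => by positivity) fun s => ?_⟩
  refine le_trans (Finset.sum_le_sum (g := fun n : ℤ => ‖fourierCoefficient f n‖ ^ 2 +
    (n : ℝ) ^ 2 * ‖fourierCoefficient f n‖ ^ 2) fun n _ => ?_) ?_
  · rw [← one_add_mul]
    refine mul_le_mul_of_nonneg_right ?_ (by positivity)
    simpa using Real.rpow_le_rpow_of_exponent_le 
      (show 1 ≤ 1 + (n : ℝ) ^ 2 by nlinarith [sq_nonneg (n : ℝ)]) ht
  · rw [Finset.sum_add_distrib]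
    exact add_le_add (sum_sq_fourierCoefficient_le hf' s)
      (sum_sq_mul_sq_fourierCoefficient_le hf' h hB s)

/-! ### Change of representative and conclusion. -/

theorem conv₂_congr {f g f₁ g₁ : Circle → ℂ} (hf : f =ᵐ[σ] f₁) (hg : g =ᵐ[σ] g₁) :
    conv₂ f g = conv₂ f₁ g₁ := by
  rw [conv₂, conv₂, WithDensityᵥEq.congr_ae]
  filter_upwards [Measure.quasiMeasurePreserving_fst.ae hf,
    Measure.quasiMeasurePreserving_snd.ae hg] with p h1 h2
  rw [h1, h2]

theorem tilde_congr {f g : Circle → ℂ} (h : f =ᵐ[σ] g) : tilde f =ᵐ[σ] tilde g := by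
  filter_upwards [measurePreserving_neg.quasiMeasurePreserving.ae h] with x hx
  simp only [tilde, hx]

/-- The estimates are made for genuinely measurable functions; this reduces an arbitrary element of
`L²` to a measurable representative. -/
theorem EulerLagrange.congr {c : ℂ} {f g : Circle → ℂ} (h : EulerLagrange c f)
    (hfg : f =ᵐ[σ] g) : EulerLagrange c g := by
  filter_upwards [h, hfg] with x hx hxg
  rw [← hxg, ← hx]
  simp only [conv₅, convDensity₂]
  rw [conv₂_congr (tilde_congr hfg) (tilde_congr hfg)]
  refine integral_congr_ae ?_
  have h1 := Measure.quasiMeasurePreserving_fst (μ := σ) (ν := σ.prod σ) |>.ae hfg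
  have h2 := (Measure.quasiMeasurePreserving_fst (μ := σ) (ν := σ)).comp
    (Measure.quasiMeasurePreserving_snd (μ := σ) (ν := σ.prod σ)) |>.ae hfg
  have h3 := (Measure.quasiMeasurePreserving_snd (μ := σ) (ν := σ)).comp
    (Measure.quasiMeasurePreserving_snd (μ := σ) (ν := σ.prod σ)) |>.ae hfg
  filter_upwards [h1, h2, h3] with p h1 h2 h3
  simp only [Function.comp] at h2 h3
  rw [h1, h2, h3]

end TomasStein

theorem lemma4 (f : Circle → ℂ) (hf : MemLp f 2 TomasStein.σ) (c : ℂ)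
    (hEL : TomasStein.EulerLagrange c f) :
    ∃ s : ℝ, 0 < s ∧ s < 1 ∧ TomasStein.MemCalH s f ∧
      ∀ t : ℝ, 0 ≤ t → t < s → TomasStein.MemSobolev t f := by
  have hae := hf.1.ae_eq_mk
  obtain ⟨B, hB, hBt⟩ := (hEL.congr hae).exists_eLpNorm_rotate_sub_le
    hf.1.stronglyMeasurable_mk.measurable ((memLp_congr_ae hae).1 hf)
  have h : ∀ t : ℝ, eLpNorm (fun x => TomasStein.rotate t f x - f x) 2 TomasStein.σ ≤
      ENNReal.ofReal (B * |t|) := fun t => by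
    refine le_trans (eLpNorm_congr_ae ?_).le (hBt t)
    filter_upwards [hae, (TomasStein.measurePreserving_mul
      (Circle.exp t)).quasiMeasurePreserving.ae hae] with x h1 h2
    simp only [TomasStein.rotate, h1, h2]
  -- The Lipschitz bound would allow any exponent in `(0, 1)`; `1 / 2` is an arbitrary choice.
  exact ⟨1 / 2, by norm_num, by norm_num, TomasStein.memCalH_half hf h hB, fun t _ ht =>
    TomasStein.memSobolev_of_lipschitz hf h hB (by linarith)⟩
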